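/- Let $(\varepsilon_t)_{t\in\mathbb Z}$ be a martingale difference sequence with respect to an increasing family of $\sigma$-fields $(\mathcal F_t)_{t\in\mathbb Z}$ (that is, $\varepsilon_t$ is $\mathcal F_t$-measurable and $E(\varepsilon_t\mid\mathcal F_{t-1})=0$ a.s.) such that, for some $\sigma>0$ and some $\alpha>2$, $E(\varepsilon_t^2\mid\mathcal F_{t-1})=\sigma^2$ a.s. for all $t$ and $\sup_t E(|\varepsilon_t|^\alpha\mid\mathcal F_{t-1})<\infty$ a.s. Let $(x_t)_{t\in\mathbb Z}$ be a (weakly) stationary solution of $$x_{t+1}=\sum_{i=1}^{p_1}a_i x_{t+1-i}+\varepsilon_{t+1},$$ where $p_1\ge1$, $a_{p_1}\ne0$ and $1-a_1z-\dots-a_{p_1}z^{p_1}\neq0$ for all complex $z$ with $|z|\le1$. Let $b_0=1,b_1,b_2,\dots$ be the power series coefficients of $1/(1-a_1z-\dots-a_{p_1}z^{p_1})$. Notation. Put $\mathbf x_j(k)=(x_j,\dots,x_{j-k+1})'$, $\gamma_j=E(x_tx_{t-j})$, $\Gamma(k)=E(\mathbf x_1(k)\mathbf x_1(k)')$ and $\mathbf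 a_D(h,k)=\Gamma(k)^{-1}(\gamma_h,\dots,\gamma_{h+k-1})'$. For $c\in\mathbb R^k$ let $A[c]$ be the $k\times k$ matrix whose first column is $c$ and whose last $k-1$ columns are $I_{k-1}$ on top of a zero row; put $A(k)=A[\mathbf a_D(1,k)]$ and $\mathbf a(h,k)=A(k)^{h-1}\mathbf a_D(1,k)$. Let $\eta_{t,h}=\sum_{j=0}^{h-1}b_j\varepsilon_{t+h-j}$. Let $p_h$ be the order of the $h$-step prediction model, i.e. the smallest $p$ such that the linear predictor of $x_{t+h}$ based on the infinite past $x_t,x_{t-1},\dots$ with the smallest mean-squared error is a linear combination of $x_t,\dots,x_{t-p+1}$. Estimators. Let $\hat\Gamma_n(h,k)=\frac1{n-h-k+1}\sum_{j=k}^{n-h}\mathbf x_j(k)\mathbf x_j(k)'$; let the direct estimator $\check{\mathbf a}_n(h,k)$ solve $\hat\Gamma_n(h,k)\check{\mathbf a}_n(h,k)=\frac1{n-h-k+1}\sum_{j=k}^{n-h}\mathbf x_j(k)x_{j+h}$, and let the plug-in estimator be $\hat{\mathbf a}_n(1,k)=\check{\mathbf a}_n(1,k)$, $\hat{\mathbf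 a}_n(h,k)=A[\hat{\mathbf a}_n(1,k)]^{h-1}\hat{\mathbf a}_n(1,k)$. Fix $h\ge1$ and $K\ge p_1$, and let $m_h$ be the smallest positive integer such that $\hat{\mathbf a}_i(h,K)$ and $\check{\mathbf a}_i(h,K)$ are well defined (i.e. $\hat\Gamma_i(1,K)$ and $\hat\Gamma_i(h,K)$ are nonsingular) for all $i\ge m_h$. The accumulated prediction errors are $$\mathrm{APE}\,P_{n,h}(k)=\sum_{i=m_h}^{n-h}\bigl(x_{i+h}-\mathbf x_i(k)'\hat{\mathbf a}_i(h,k)\bigr)^2,\qquad \mathrm{APE}\,D_{n,h}(k)=\sum_{i=m_h}^{n-h}\bigl(x_{i+h}-\mathbf x_i(k)'\check{\mathbf a}_i(h,k)\bigr)^2 .$$ Theorem. (i) For every $1\le k<p_1$, almost surely as $n\to\infty$, $$\frac1n\Bigl(\mathrm{APE}\,P_{n,h}(k)-\sum_{i=m_h}^{n-h}\eta_{i,h}^2\Bigr)\to(\mathbf a_D(h,p_1)-\mathbf a_D(h,k))'\Gamma(p_1)(\mathbf a_D(h,p_1)-\mathbf a_D(h,k))+(\mathbf a(h,k)-\mathbf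 a_D(h,k))'\Gamma(k)(\mathbf a(h,k)-\mathbf a_D(h,k)),$$ where $\mathbf a_D(h,k)$ in the first term is viewed as a $p_1$-dimensional vector with undefined entries set to zero. (ii) For every $1\le k<p_h$, almost surely as $n\to\infty$, $$\frac1n\Bigl(\mathrm{APE}\,D_{n,h}(k)-\sum_{i=m_h}^{n-h}\eta_{i,h}^2\Bigr)\to(\mathbf a_D(h,p_h)-\mathbf a_D(h,k))'\Gamma(p_h)(\mathbf a_D(h,p_h)-\mathbf a_D(h,k)),$$ where $\mathbf a_D(h,k)$ is viewed as a $p_h$-dimensional vector with undefined entries set to zero. -/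

import Mathlib

open MeasureTheory ProbabilityTheory Filter Topology

namespace MultistepAR

noncomputable section

/-! ### The autoregressive model and its moving-average coefficients -/

/-- Second-order (weak) stationarity of a real process indexed by `ℤ`. -/
structure IsWeaklyStationary {Ω : Type*} [MeasurableSpace Ω] (μ : Measure Ω)
    (x : ℤ → Ω → ℝ) : Prop where
  memLp : ∀ t, MemLp (x t) 2 μ
  mean_eq : ∀ s t, ∫ ω, x s ω ∂μ = ∫ ω, x t ω ∂μ
  cov_eq : ∀ s t l, covariance (x (s + l)) (x s) μ = covariance (x (t + l)) (x t) μ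

/-- `x` is a stationary AR(`p`) process with noise `ε` and coefficients `a₁, …, a_p`
(`a i` is the coefficient `a_{i+1}`, of the lag `i + 1`): the order `p ≥ 1` is exact and
`1 - a₁ z - ⋯ - a_p z ^ p` has no complex zero in the closed unit disc. -/
structure IsStationaryAR {Ω : Type*} [MeasurableSpace Ω] (μ : Measure Ω) (p : ℕ)
    (a : Fin p → ℝ) (x ε : ℤ → Ω → ℝ) : Prop where
  stationary : IsWeaklyStationary μ x
  order_exact : ∃ i : Fin p, (i : ℕ) + 1 = p ∧ a i ≠ 0
  no_zero : ∀ z : ℂ, ‖z‖ ≤ 1 → 1 - ∑ i : Fin p, (a i : ℂ) * z ^ ((i : ℕ) + 1) ≠ 0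
  recursion : ∀ t : ℤ, ∀ᵐ ω ∂μ,
    x (t + 1) ω = ∑ i : Fin p, a i * x (t - ((i : ℕ) : ℤ)) ω + ε (t + 1) ω

/-- The noise is a martingale difference sequence with respect to `ℱ`, with constant conditional
variance `σ ^ 2` and `sup_t E(|ε_t| ^ α | ℱ_{t-1}) < ∞` almost surely. The last conditional
expectation is the one of a `[0, ∞]`-valued variable; no unconditional moment of order `α` is
assumed. -/
structure IsMartingaleNoise {Ω : Type*} {mΩ : MeasurableSpace Ω} (μ : Measure Ω)
    (ℱ : Filtration ℤ mΩ) (σ α : ℝ) (ε : ℤ → Ω → ℝ) : Prop where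
  adapted : ∀ t, Measurable[ℱ t] (ε t)
  memLp : ∀ t, MemLp (ε t) 2 μ
  condMean : ∀ t, μ[ε t | ℱ (t - 1)] =ᵐ[μ] 0
  condVar : ∀ t, μ[fun ω => ε t ω ^ 2 | ℱ (t - 1)] =ᵐ[μ] fun _ => σ ^ 2
  condMoment : ∀ᵐ ω ∂μ,
    (⨆ t : ℤ, condLExp (ℱ (t - 1)) μ (fun ω' => ENNReal.ofReal (|ε t ω'| ^ α)) ω) < ⊤

/-- The coefficients `b_j` of the moving-average representation `x_t = ∑_{j ≥ 0} b_j ε_{t-j}`,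
i.e. of the power series `1 / (1 - a₁ z - ⋯ - a_p z ^ p)`. -/
def maCoeff {p : ℕ} (a : Fin p → ℝ) (j : ℕ) : ℝ :=
  PowerSeries.coeff j
    (1 - ∑ i : Fin p, PowerSeries.C (a i) * PowerSeries.X ^ ((i : ℕ) + 1) : PowerSeries ℝ)⁻¹

/-- `η_{t,h} = ∑_{j=0}^{h-1} b_j ε_{t+h-j}`, along one noise path `e`. -/
def eta {p : ℕ} (a : Fin p → ℝ) (e : ℤ → ℝ) (h : ℕ) (t : ℤ) : ℝ :=
  ∑ j ∈ Finset.range h, maCoeff a j * e (t + h - j)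

/-! ### Population quantities -/

/-- `γ_j = E(x_t x_{t-j})` (for `t = 0`). -/
def autocov {Ω : Type*} [MeasurableSpace Ω] (μ : Measure Ω) (x : ℤ → Ω → ℝ) (j : ℤ) : ℝ :=
  ∫ ω, x 0 ω * x (-j) ω ∂μ

/-- The vector `𝐱_j(k) = (u_j, u_{j-1}, …, u_{j-k+1})'` along a path `u`. -/
def lagVec (u : ℤ → ℝ) (k : ℕ) (j : ℤ) : Fin k → ℝ :=
  fun i => u (j - ((i : ℕ) : ℤ))

/-- `Γ(k) = E(𝐱₁(k) 𝐱₁(k)')`. -/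
def covMatrix {Ω : Type*} [MeasurableSpace Ω] (μ : Measure Ω) (x : ℤ → Ω → ℝ) (k : ℕ) :
    Matrix (Fin k) (Fin k) ℝ :=
  Matrix.of fun i j =>
    ∫ ω, lagVec (fun t => x t ω) k 1 i * lagVec (fun t => x t ω) k 1 j ∂μ

/-- `𝐚_D(h, k) = Γ(k)⁻¹ (γ_h, …, γ_{h+k-1})'`. -/
def directCoef {Ω : Type*} [MeasurableSpace Ω] (μ : Measure Ω) (x : ℤ → Ω → ℝ) (h k : ℕ) :
    Fin k → ℝ :=
  Matrix.mulVec (covMatrix μ x k)⁻¹ fun i => autocov μ x (h + (i : ℕ))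

/-- The `k × k` matrix with first column `c` whose remaining `k - 1` columns are the identity
`I_{k-1}` on top of a row of zeros. -/
def companion {k : ℕ} (c : Fin k → ℝ) : Matrix (Fin k) (Fin k) ℝ :=
  Matrix.of fun i j =>
    if (j : ℕ) = 0 then c i else if (j : ℕ) = (i : ℕ) + 1 then 1 else 0

/-- `A^{h-1} c` with `A = companion c`: the `h`-step coefficients obtained by iterating the
one-step coefficients `c` (used for `h ≥ 1` only). -/
def iterateCoef {k : ℕ} (h : ℕ) (c : Fin k → ℝ) : Fin k → ℝ :=
  Matrix.mulVec (companion c ^ (h - 1)) c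

/-- `𝐚(h, k) = A(k)^{h-1} 𝐚_D(1, k)`, the limit of the plug-in coefficients. -/
def plugInCoef {Ω : Type*} [MeasurableSpace Ω] (μ : Measure Ω) (x : ℤ → Ω → ℝ) (h k : ℕ) :
    Fin k → ℝ :=
  iterateCoef h (directCoef μ x 1 k)

/-- `∑_{j=1}^{p} c_j x_{t+1-j}` is, for every `t`, a linear predictor of `x_{t+h}` based on the
infinite past `x_t, x_{t-1}, …` with the smallest mean-squared prediction error. (Finite linear
combinations are dense in the closed linear span of the past, so comparing with these is
enough.) -/
def IsBestLinearPredictor {Ω : Type*} [MeasurableSpace Ω] (μ : Measure Ω) (x : ℤ → Ω → ℝ)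
    (h p : ℕ) (c : Fin p → ℝ) : Prop :=
  ∀ (t : ℤ) (N : ℕ) (d : Fin N → ℝ),
    ∫ ω, (x (t + h) ω - lagVec (fun s => x s ω) p t ⬝ᵥ c) ^ 2 ∂μ ≤
      ∫ ω, (x (t + h) ω - lagVec (fun s => x s ω) N t ⬝ᵥ d) ^ 2 ∂μ

/-- The order `p_h` of the `h`-step prediction model: the smallest `p` for which the best linear
predictor of `x_{t+h}` from the infinite past only involves `x_t, …, x_{t-p+1}`. By minimality
the last coefficient is nonzero. -/
def predictionOrder {Ω : Type*} [MeasurableSpace Ω] (μ : Measure Ω) (x : ℤ → Ω → ℝ)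
    (h : ℕ) : ℕ :=
  sInf {p : ℕ | ∃ c : Fin p → ℝ, IsBestLinearPredictor μ x h p c}

/-- A `k`-dimensional vector viewed as a `q`-dimensional one, undefined entries set to zero. -/
def zeroExtend {k : ℕ} (q : ℕ) (v : Fin k → ℝ) : Fin q → ℝ :=
  fun i => if hi : (i : ℕ) < k then v ⟨i, hi⟩ else 0

/-- The quadratic form `v' G v`. -/
def quadForm {k : ℕ} (G : Matrix (Fin k) (Fin k) ℝ) (v : Fin k → ℝ) : ℝ :=
  v ⬝ᵥ Matrix.mulVec G v

/-! ### Estimators, predictors and accumulated prediction errors along a path `u` -/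

/-- `Γ̂_n(h, k) = (n-h-k+1)⁻¹ ∑_{j=k}^{n-h} 𝐱_j(k) 𝐱_j(k)'`. -/
def sampleCov (u : ℤ → ℝ) (h k n : ℕ) : Matrix (Fin k) (Fin k) ℝ :=
  ((n : ℝ) - h - k + 1)⁻¹ •
    ∑ j ∈ Finset.Icc k (n - h), Matrix.vecMulVec (lagVec u k j) (lagVec u k j)

/-- The direct least-squares estimator `ǎ_n(h, k)`, the solution `a` of
`Γ̂_n(h, k) a = (n-h-k+1)⁻¹ ∑_{j=k}^{n-h} 𝐱_j(k) u_{j+h}`. For `h = 1` this is also the one-step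
estimator `â_n(1, k)`. -/
def directEst (u : ℤ → ℝ) (h k n : ℕ) : Fin k → ℝ :=
  Matrix.mulVec (sampleCov u h k n)⁻¹
    (((n : ℝ) - h - k + 1)⁻¹ • ∑ j ∈ Finset.Icc k (n - h), u ((j : ℤ) + h) • lagVec u k j)

/-- The plug-in estimator `â_n(h, k) = Â_n(k)^{h-1} â_n(1, k)`. -/
def plugInEst (u : ℤ → ℝ) (h k n : ℕ) : Fin k → ℝ :=
  iterateCoef h (directEst u 1 k n)

/-- `m_h`: the smallest positive integer such that `â_i(h, K)` and `ǎ_i(h, K)` are well defined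
(their normal equations are nonsingular) for all `i ≥ m_h`. -/
def startIndex (u : ℤ → ℝ) (h K : ℕ) : ℕ :=
  sInf {m : ℕ | 1 ≤ m ∧ ∀ i, m ≤ i →
    IsUnit (sampleCov u 1 K i).det ∧ IsUnit (sampleCov u h K i).det}

/-- `APE P_{n,h}(k) = ∑_{i=m_h}^{n-h} (u_{i+h} - 𝐱_i(k)' â_i(h, k)) ^ 2`. -/
def apePlugIn (u : ℤ → ℝ) (h K k n : ℕ) : ℝ :=
  ∑ i ∈ Finset.Icc (startIndex u h K) (n - h),
    (u ((i : ℤ) + h) - lagVec u k i ⬝ᵥ plugInEst u h k i) ^ 2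

/-- `APE D_{n,h}(k) = ∑_{i=m_h}^{n-h} (u_{i+h} - 𝐱_i(k)' ǎ_i(h, k)) ^ 2`. -/
def apeDirect (u : ℤ → ℝ) (h K k n : ℕ) : ℝ :=
  ∑ i ∈ Finset.Icc (startIndex u h K) (n - h),
    (u ((i : ℤ) + h) - lagVec u k i ⬝ᵥ directEst u h k i) ^ 2

/-- `∑_{i=m_h}^{n-h} η_{i,h} ^ 2`, with the same starting index `m_h` (of the path `u`). -/
def sumEtaSq {p : ℕ} (a : Fin p → ℝ) (u e : ℤ → ℝ) (h K n : ℕ) : ℝ :=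
  ∑ i ∈ Finset.Icc (startIndex u h K) (n - h), eta a e h i ^ 2

end

end MultistepAR

/-! The heart of the matter is a law of large numbers: almost surely, `n⁻¹ ∑ x_{i+s} x_{i+t}` tends
to `E(x_s x_t)` for all `s`, `t`. Only weak stationarity is assumed, so no ergodic theorem applies,
and the limit is extracted from the recursion and from the martingale structure of the noise.

In vector form `𝐱_{m+1} = Φ 𝐱_m + ε_{m+1} e₀`. Let `S_n` be the average of `𝐱_m 𝐱_m'` over `m < n`.
Then `S_n - Φ S_n Φ'` consists of a telescoping boundary term, of averages of past values times new
noise, and of the average of the squared noise. The boundary term vanishes because the noise, hence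
by stability also the process, is `o(√n)`. The averages with noise are handled by a strong law for
martingale differences bounded in `L^p`, `1 < p ≤ 2`: with `p = 2` for the cross products, and with
some `p ≤ α / 2` for `ε² - σ²`, after localising to events on which the conditional `α`-th moment is
bounded. So `S_n - Φ S_n Φ'` tends to `σ² e₀ e₀'`. The covariance matrix `Γ` satisfies `Γ - Φ Γ Φ' =
σ² e₀ e₀'`, and `G ↦ G - Φ G Φ'` is invertible because the spectral radius of `Φ` is less than one;
hence `S_n → Γ`. Padding the coefficients by zeros reaches all lags
(`IsStationaryAR.ae_hasMean_mul`).

Consequently the least-squares coefficients converge, and so do the plug-in coefficients, which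
depend continuously on them. Replacing estimates by their limit `θ` does not affect Cesàro means of
squared errors (`HasMean.sq_sub_of_tendsto`), so the normalised accumulated error tends to `E(x_h -
𝐱₀(k)'θ)²`. Subtracting `E η²` leaves two quadratic forms by Pythagoras
(`IsStableAR.integral_sq_sub_dotProduct`): the error is the sum of the innovation, of the gap
between the full and the order-`k` projection, and of the gap between that projection and `θ`, which
are pairwise orthogonal. For the direct method `θ` is the projection itself and the last gap
disappears. -/

namespace MultistepAR

/-! ### Cesàro means -/

/-- The averages `n⁻¹ ∑_{i < n} f i` converge to `L`. -/
def HasMean (f : ℕ → ℝ) (L : ℝ) : Prop :=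
  Tendsto (fun n : ℕ => (∑ i ∈ Finset.range n, f i) / (n : ℝ)) atTop (𝓝 L)

namespace HasMean

variable {f g : ℕ → ℝ} {L M : ℝ}

theorem add (hf : HasMean f L) (hg : HasMean g M) : HasMean (fun i => f i + g i) (L + M) := by
  unfold HasMean at *
  refine (Tendsto.add hf hg).congr fun n => ?_
  rw [Finset.sum_add_distrib, add_div]

theorem const_mul (c : ℝ) (hf : HasMean f L) : HasMean (fun i => c * f i) (c * L) := by
  unfold HasMean at *
  refine (Tendsto.const_mul c hf).congr fun n => ?_
  rw [← Finset.mul_sum, mul_div_assoc]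

theorem sub (hf : HasMean f L) (hg : HasMean g M) : HasMean (fun i => f i - g i) (L - M) := by
  have := hf.add (hg.const_mul (-1))
  simpa [sub_eq_add_neg] using this

theorem sum {ι : Type*} (s : Finset ι) {f : ι → ℕ → ℝ} {L : ι → ℝ}
    (hf : ∀ j ∈ s, HasMean (f j) (L j)) :
    HasMean (fun i => ∑ j ∈ s, f j i) (∑ j ∈ s, L j) := by
  unfold HasMean at *
  refine (tendsto_finsetSum s hf).congr fun n => ?_
  rw [Finset.sum_comm, Finset.sum_div]

theorem of_tendsto (hf : Tendsto f atTop (𝓝 L)) : HasMean f L := by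
  unfold HasMean
  refine hf.cesaro.congr fun n => ?_
  rw [div_eq_inv_mul]

theorem congr (hf : HasMean f L) (h : ∀ i, f i = g i) : HasMean g L := by
  rwa [← funext h]

theorem const (c : ℝ) : HasMean (fun _ => c) c := of_tendsto tendsto_const_nhds

/-- The terms of a Cesàro convergent sequence are `o(n)`. -/
theorem tendsto_div_zero (hf : HasMean f L) :
    Tendsto (fun n : ℕ => f n / (n : ℝ)) atTop (𝓝 0) := by
  unfold HasMean at hf
  have h1 := (tendsto_add_atTop_iff_nat 1).2 hf
  have h2 : Tendsto (fun n : ℕ => ((n : ℝ) + 1) / n) atTop (𝓝 1) := by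
    have : Tendsto (fun n : ℕ => 1 + 1 / (n : ℝ)) atTop (𝓝 (1 + 0)) :=
      tendsto_const_nhds.add tendsto_one_div_atTop_nhds_zero_nat
    rw [add_zero] at this
    refine this.congr' ?_
    filter_upwards [eventually_gt_atTop 0] with n hn
    have : (n : ℝ) ≠ 0 := by positivity
    field_simp
  -- With `A_n` the `n`-th average, `f n / n = A_{n+1} (n + 1) / n - A_n`.
  have h3 := (h1.mul h2).sub hf
  rw [mul_one, sub_self] at h3
  refine h3.congr' ?_
  filter_upwards [eventually_gt_atTop 0] with n hn
  have : (n : ℝ) ≠ 0 := by positivity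
  rw [Finset.sum_range_succ]
  push_cast
  field_simp
  ring

theorem shift_one (hf : HasMean f L) : HasMean (fun i => f (i + 1)) L := by
  have h0 : Tendsto (fun n : ℕ => f 0 / (n : ℝ)) atTop (𝓝 0) :=
    tendsto_const_nhds.div_atTop tendsto_natCast_atTop_atTop
  have h1 := hf.tendsto_div_zero
  unfold HasMean at *
  have := (hf.add h1).sub h0
  rw [add_zero, sub_zero] at this
  refine this.congr fun n => ?_
  rw [← add_div, ← Finset.sum_range_succ, Finset.sum_range_succ', ← sub_div]
  simp

theorem shift (hf : HasMean f L) (k : ℕ) : HasMean (fun i => f (i + k)) L := by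
  induction k with
  | zero => simpa using hf
  | succ k ih => exact ih.shift_one.congr fun i => by congr 1; ring

/-- Sums over a window with fixed left end and right end `n - h`. -/
theorem tendsto_Icc (hf : HasMean f L) (m h : ℕ) :
    Tendsto (fun n : ℕ => (∑ i ∈ Finset.Icc m (n - h), f i) / (n : ℝ)) atTop (𝓝 L) := by
  -- Replacing `n` by `n + h + m` removes the truncated subtraction: the window then has exactly `n
  -- + 1` terms.
  rw [← tendsto_add_atTop_iff_nat (h + m)]
  have hs := (hf.shift m)
  have hs' : Tendsto (fun n : ℕ => (∑ i ∈ Finset.range (n + 1), f (i + m)) / ((n + 1 : ℕ) : ℝ))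
      atTop (𝓝 L) := (tendsto_add_atTop_iff_nat 1).2 hs
  have hr : Tendsto (fun n : ℕ => ((n + 1 : ℕ) : ℝ) / ((n + (h + m) : ℕ) : ℝ)) atTop (𝓝 1) := by
    have h1 : Tendsto (fun n : ℕ => (((h + m : ℕ) : ℝ) - 1) / ((n + (h + m) : ℕ) : ℝ))
        atTop (𝓝 0) :=
      tendsto_const_nhds.div_atTop
        (tendsto_natCast_atTop_atTop.comp (tendsto_add_atTop_nat (h + m)))
    have h2 := (tendsto_const_nhds (x := (1 : ℝ))).sub h1
    rw [sub_zero] at h2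
    refine h2.congr' ?_
    filter_upwards [eventually_gt_atTop 0] with n hn
    have : ((n + (h + m) : ℕ) : ℝ) ≠ 0 := by positivity
    rw [eq_div_iff this, sub_mul, div_mul_cancel₀ _ this]
    push_cast
    ring
  have := hs'.mul hr
  rw [mul_one] at this
  refine this.congr fun n => ?_
  have hsum : ∑ i ∈ Finset.Icc m (n + (h + m) - h), f i
      = ∑ i ∈ Finset.range (n + 1), f (i + m) := by
    have : Finset.Icc m (n + (h + m) - h) = Finset.Ico m (n + 1 + m) := by
      ext i; simp only [Finset.mem_Icc, Finset.mem_Ico]; omega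
    rw [this, Finset.sum_Ico_eq_sum_range]
    have : n + 1 + m - m = n + 1 := by omega
    rw [this]
    exact Finset.sum_congr rfl fun i _ => by rw [add_comm]
  rw [hsum, div_mul_div_comm, mul_comm (∑ i ∈ _, _), mul_div_mul_left]
  positivity

/-- A null sequence times a sequence with Cesàro bounded absolute values has mean zero. -/
theorem mul_null {δ : ℕ → ℝ} (hδ : Tendsto δ atTop (𝓝 0)) (hf : HasMean g L)
    (hfg : ∀ i, |f i| ≤ g i) :
    HasMean (fun i => δ i * f i) 0 := by
  have hL : 0 ≤ L := ge_of_tendsto' hf fun n =>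
    div_nonneg (Finset.sum_nonneg fun i _ => (abs_nonneg _).trans (hfg i)) (Nat.cast_nonneg n)
  have hlim := hf
  unfold HasMean at *
  rw [Metric.tendsto_atTop]
  intro e he
  -- This choice gives `c * L < e`. Beyond `N` the sum is at most `c ∑ g i`; the finitely many
  -- earlier terms vanish after division by `n`.
  set c := e / (2 * (L + 1)) with hc
  have hcpos : 0 < c := by positivity
  obtain ⟨N, hN⟩ := (Metric.tendsto_atTop.1 hδ) c hcpos
  have hA : Tendsto (fun n : ℕ => (∑ i ∈ Finset.range N, |δ i * f i|) / (n : ℝ)) atTop (𝓝 0) :=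
    tendsto_const_nhds.div_atTop tendsto_natCast_atTop_atTop
  have hA' := hA.add (hlim.const_mul c)
  have hlt : 0 + c * L < e := by
    rw [hc, zero_add, div_mul_eq_mul_div, div_lt_iff₀ (by positivity)]
    nlinarith
  obtain ⟨N', hN'⟩ := eventually_atTop.1 (hA'.eventually_lt_const hlt)
  refine ⟨max N N', fun n hn => ?_⟩
  have h1 := hN' n (le_of_max_le_right hn)
  have hNn := le_of_max_le_left hn
  rw [dist_zero_right, Real.norm_eq_abs, abs_div, Nat.abs_cast]
  refine lt_of_le_of_lt ?_ h1
  rw [← mul_div_assoc, ← add_div]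
  refine div_le_div_of_nonneg_right ?_ (Nat.cast_nonneg n)
  refine (Finset.abs_sum_le_sum_abs _ _).trans ?_
  rw [Finset.mul_sum, ← Finset.sum_range_add_sum_Ico _ hNn,
    ← Finset.sum_range_add_sum_Ico (fun i => c * g i) hNn]
  have h2 : ∑ i ∈ Finset.Ico N n, |δ i * f i| ≤ ∑ i ∈ Finset.Ico N n, c * g i := by
    refine Finset.sum_le_sum fun i hi => ?_
    rw [abs_mul]
    have := hN i (Finset.mem_Ico.1 hi).1
    rw [dist_zero_right, Real.norm_eq_abs] at this
    exact mul_le_mul this.le (hfg i) (abs_nonneg _) hcpos.le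
  have h3 : 0 ≤ ∑ i ∈ Finset.range N, c * g i :=
    Finset.sum_nonneg fun i _ => mul_nonneg hcpos.le ((abs_nonneg _).trans (hfg i))
  linarith

/-- **Kronecker's lemma** for the weights `i + 1`. -/
theorem of_tendsto_sum_div {s : ℝ}
    (hs : Tendsto (fun n : ℕ => ∑ i ∈ Finset.range n, f i / ((i : ℝ) + 1)) atTop (𝓝 s)) :
    HasMean f 0 := by
  set S := fun n : ℕ => ∑ i ∈ Finset.range n, f i / ((i : ℝ) + 1) with hS
  -- Abel summation. Divided by `n`, the right side is `S n` minus its own Cesàro mean, and both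
  -- tend to `s`.
  have key : ∀ n : ℕ, ∑ i ∈ Finset.range n, f i = n * S n - ∑ i ∈ Finset.range n, S i := by
    intro n
    induction n with
    | zero => simp
    | succ n ih =>
      have h1 : S (n + 1) = S n + f n / ((n : ℝ) + 1) := by
        simp only [hS, Finset.sum_range_succ]
      have h2 : ((n : ℝ) + 1) ≠ 0 := by positivity
      rw [Finset.sum_range_succ, ih, Finset.sum_range_succ _ n, h1]
      push_cast
      field_simp
      ring
  have h1 := hs.sub (of_tendsto hs)
  unfold HasMean
  rw [sub_self] at h1
  refine h1.congr' ?_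
  filter_upwards [eventually_gt_atTop 0] with n hn
  have : (n : ℝ) ≠ 0 := by positivity
  rw [key]
  field_simp

end HasMean

/-! ### A strong law of large numbers for martingale differences -/

/-- Splitting a variable at a level `c`: the part below has a controlled second moment, the part
above a controlled first moment. -/
theorem truncation_bounds {Ω : Type*} {mΩ : MeasurableSpace Ω} {μ : Measure Ω}
    {D : Ω → ℝ} {c p C : ℝ} (hc : 0 < c) (hp : 1 < p) (hp2 : p ≤ 2)
    (hpint : Integrable (fun ω => |D ω| ^ p) μ)
    (hC : ∫ ω, |D ω| ^ p ∂μ ≤ C) :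
    ∫ ω, ({ω | |D ω| ≤ c}.indicator D ω) ^ 2 ∂μ ≤ c ^ (2 - p) * C ∧
    ∫ ω, |D ω - {ω | |D ω| ≤ c}.indicator D ω| ∂μ ≤ c ^ (1 - p) * C := by
  constructor
  · calc ∫ ω, ({ω | |D ω| ≤ c}.indicator D ω) ^ 2 ∂μ
        ≤ ∫ ω, c ^ (2 - p) * |D ω| ^ p ∂μ := by
          refine integral_mono_of_nonneg (ae_of_all _ fun ω => sq_nonneg _)
            (hpint.const_mul _) (ae_of_all _ fun ω => ?_)
          by_cases h : |D ω| ≤ c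
          · simp only [Set.indicator, Set.mem_ofPred_eq, h, if_true]
            have h1 : D ω ^ 2 = |D ω| ^ (2 - p) * |D ω| ^ p := by
              rw [← Real.rpow_add_of_nonneg (abs_nonneg _) (by linarith) (by linarith)]
              simp
            rw [h1]
            gcongr
          · simp only [Set.indicator, Set.mem_ofPred_eq, h, if_false]
            have : (0 : ℝ) ≤ c ^ (2 - p) * |D ω| ^ p := by positivity
            simpa using this
      _ ≤ c ^ (2 - p) * C := by
          rw [integral_const_mul]; gcongr
  · calc ∫ ω, |D ω - {ω | |D ω| ≤ c}.indicator D ω| ∂μ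
        ≤ ∫ ω, c ^ (1 - p) * |D ω| ^ p ∂μ := by
          refine integral_mono_of_nonneg (ae_of_all _ fun ω => abs_nonneg _)
            (hpint.const_mul _) (ae_of_all _ fun ω => ?_)
          by_cases h : |D ω| ≤ c
          · simp only [Set.indicator, Set.mem_ofPred_eq, h, if_true, sub_self, abs_zero]
            positivity
          · simp only [Set.indicator, Set.mem_ofPred_eq, h, if_false, sub_zero]
            push Not at h
            have h0 : 0 < |D ω| := hc.trans h
            have h1 : |D ω| = |D ω| ^ (1 - p) * |D ω| ^ p := by
              rw [← Real.rpow_add h0]; simp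
            conv_lhs => rw [h1]
            exact mul_le_mul_of_nonneg_right
              (Real.rpow_le_rpow_of_nonpos hc h.le (by linarith)) (by positivity)
      _ ≤ c ^ (1 - p) * C := by
          rw [integral_const_mul]; gcongr

section SLLN

variable {Ω : Type*} {mΩ : MeasurableSpace Ω} {μ : Measure Ω} [IsProbabilityMeasure μ]

theorem integral_mul_eq_zero_of_condExp_eq_zero {m : MeasurableSpace Ω} (hm : m ≤ mΩ)
    {f g : Ω → ℝ} (hf : AEStronglyMeasurable[m] f μ) (hfg : Integrable (f * g) μ)
    (hg : Integrable g μ) (hg0 : μ[g | m] =ᵐ[μ] 0) : ∫ ω, f ω * g ω ∂μ = 0 := by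
  have h1 := condExp_mul_of_aestronglyMeasurable_left hf hfg hg
  have h2 : ∫ ω, (μ[f * g | m]) ω ∂μ = ∫ ω, (f * g) ω ∂μ := integral_condExp hm
  have h3 : ∫ ω, (μ[f * g | m]) ω ∂μ = 0 := by
    rw [integral_congr_ae (g := fun _ => (0 : ℝ)), integral_zero]
    filter_upwards [h1, hg0] with ω h h'
    rw [h, Pi.mul_apply, h', Pi.zero_apply, mul_zero]
  rw [← h3, h2]
  rfl

/-- The second moment of a sum of square-integrable martingale differences. -/
theorem integral_sq_sum {𝒢 : Filtration ℕ mΩ} {d : ℕ → Ω → ℝ}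
    (hmeas : ∀ i, StronglyMeasurable[𝒢 (i + 1)] (d i)) (hL2 : ∀ i, MemLp (d i) 2 μ)
    (hcond : ∀ i, μ[d i | 𝒢 i] =ᵐ[μ] 0) (n : ℕ) :
    ∫ ω, (∑ i ∈ Finset.range n, d i ω) ^ 2 ∂μ = ∑ i ∈ Finset.range n, ∫ ω, d i ω ^ 2 ∂μ := by
  induction n with
  | zero => simp
  | succ n ih =>
    have hS : MemLp (fun ω => ∑ i ∈ Finset.range n, d i ω) 2 μ :=
      memLp_finsetSum _ fun i _ => hL2 i
    have hSm : StronglyMeasurable[𝒢 n] (fun ω => ∑ i ∈ Finset.range n, d i ω) := by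
      refine Finset.stronglyMeasurable_fun_sum _ fun i hi => ?_
      exact (hmeas i).mono (𝒢.mono (Finset.mem_range.1 hi))
    have hprod : Integrable ((fun ω => ∑ i ∈ Finset.range n, d i ω) * d n) μ :=
      hS.integrable_mul (hL2 n)
    have h0 := integral_mul_eq_zero_of_condExp_eq_zero (𝒢.le n) hSm.aestronglyMeasurable hprod
      ((hL2 n).integrable one_le_two) (hcond n)
    have e : ∀ ω, (∑ i ∈ Finset.range (n + 1), d i ω) ^ 2
        = (∑ i ∈ Finset.range n, d i ω) ^ 2 + 2 * ((∑ i ∈ Finset.range n, d i ω) * d n ω)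
          + d n ω ^ 2 := fun ω => by
      rw [Finset.sum_range_succ]; ring
    have i1 : Integrable (fun ω => (∑ i ∈ Finset.range n, d i ω) ^ 2) μ := hS.integrable_sq
    have i2 : Integrable (fun ω => 2 * ((∑ i ∈ Finset.range n, d i ω) * d n ω)) μ :=
      hprod.const_mul 2
    have i3 : Integrable (fun ω => (∑ i ∈ Finset.range n, d i ω) ^ 2
      + 2 * ((∑ i ∈ Finset.range n, d i ω) * d n ω)) μ := i1.add i2
    simp_rw [e]
    rw [integral_add i3 (hL2 n).integrable_sq, integral_add i1 i2, integral_const_mul, h0, ih,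
      Finset.sum_range_succ]
    ring

/-- Conditional expectation is an orthogonal projection in `L²`, so Pythagoras gives the bound;
recentring a truncated variable costs nothing in second moment. -/
theorem integral_sq_sub_condExp_le {m : MeasurableSpace Ω} (hm : m ≤ mΩ) {f : Ω → ℝ}
    (hf : MemLp f 2 μ) : ∫ ω, (f ω - (μ[f | m]) ω) ^ 2 ∂μ ≤ ∫ ω, f ω ^ 2 ∂μ := by
  have hc : MemLp (μ[f | m]) 2 μ := hf.condExp one_le_two
  have hd : MemLp (f - μ[f | m]) 2 μ := hf.sub hc
  have hcd : Integrable (μ[f | m] * (f - μ[f | m])) μ := hc.integrable_mul hd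
  have h0 : ∫ ω, (μ[f | m]) ω * (f - μ[f | m]) ω ∂μ = 0 := by
    refine integral_mul_eq_zero_of_condExp_eq_zero hm
      stronglyMeasurable_condExp.aestronglyMeasurable hcd (hd.integrable one_le_two) ?_
    have h1 := condExp_sub (hf.integrable one_le_two) (integrable_condExp (f := f) (m := m)) m
    rw [condExp_of_stronglyMeasurable hm stronglyMeasurable_condExp integrable_condExp] at h1
    simpa using h1
  have e : ∀ ω, f ω ^ 2 = (f ω - (μ[f | m]) ω) ^ 2
      + 2 * ((μ[f | m]) ω * (f - μ[f | m]) ω) + (μ[f | m]) ω ^ 2 := fun ω => by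
    rw [Pi.sub_apply]; ring
  have hd2 : Integrable (fun ω => (f ω - (μ[f | m]) ω) ^ 2) μ := hd.integrable_sq
  have h2 : ∫ ω, f ω ^ 2 ∂μ = ∫ ω, (f ω - (μ[f | m]) ω) ^ 2 ∂μ + 2 * 0
      + ∫ ω, (μ[f | m]) ω ^ 2 ∂μ := by
    have i2 : Integrable (fun ω => 2 * ((μ[f | m]) ω * (f - μ[f | m]) ω)) μ := hcd.const_mul 2
    have i3 : Integrable (fun ω => (f ω - (μ[f | m]) ω) ^ 2
      + 2 * ((μ[f | m]) ω * (f - μ[f | m]) ω)) μ := hd2.add i2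
    rw [← h0, ← integral_const_mul, ← integral_add hd2 i2, ← integral_add i3 hc.integrable_sq]
    exact integral_congr_ae (ae_of_all _ e)
  have h3 : 0 ≤ ∫ ω, (μ[f | m]) ω ^ 2 ∂μ := integral_nonneg fun ω => sq_nonneg _
  linarith

/-- By Kronecker's lemma it is enough that the martingale `∑ D_i / (i + 1)` converges, and for this
that it is bounded in `L¹`. Truncating `D_i` at `i + 1` and recentring, the small part contributes
`∑ (i + 1)^(-p)` to second moments and the large part contributes the same order to first moments;
this series converges because `p > 1`. -/
theorem ae_hasMean_zero_of_stronglyMeasurable {𝒢 : Filtration ℕ mΩ} {D : ℕ → Ω → ℝ} {p C : ℝ}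
    (hmeas : ∀ i, StronglyMeasurable[𝒢 (i + 1)] (D i)) (hDint : ∀ i, Integrable (D i) μ)
    (hcond : ∀ i, μ[D i | 𝒢 i] =ᵐ[μ] 0) (hp : 1 < p) (hp2 : p ≤ 2)
    (hpint : ∀ i, Integrable (fun ω => |D i ω| ^ p) μ)
    (hC : ∀ i, ∫ ω, |D i ω| ^ p ∂μ ≤ C) :
    ∀ᵐ ω ∂μ, HasMean (fun i => D i ω) 0 := by
  have hC0 : 0 ≤ C := le_trans (integral_nonneg fun ω => by positivity) (hC 0)
  set w : ℕ → ℝ := fun i => ((i : ℝ) + 1)⁻¹ with hw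
  have hwpos : ∀ i : ℕ, 0 < ((i : ℝ) + 1) := fun i => by positivity
  have hw0 : ∀ i, 0 ≤ w i := fun i => (inv_pos.2 (hwpos i)).le
  set A : ℕ → Ω → ℝ := fun i => {ω | |D i ω| ≤ (i : ℝ) + 1}.indicator (D i) with hA
  have hAbd : ∀ i ω, |A i ω| ≤ (i : ℝ) + 1 := by
    intro i ω
    by_cases h : |D i ω| ≤ (i : ℝ) + 1
    · simp [hA, h]
    · simp [hA, h, (hwpos i).le]
  have hAm : ∀ i, StronglyMeasurable[𝒢 (i + 1)] (A i) := fun i =>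
    (hmeas i).indicator (((hmeas i).norm).measurable measurableSet_Iic)
  have hAL2 : ∀ i, MemLp (A i) 2 μ := fun i =>
    MemLp.of_bound ((hAm i).mono (𝒢.le _)).aestronglyMeasurable ((i : ℝ) + 1)
      (ae_of_all _ fun ω => hAbd i ω)
  -- Truncation destroys the martingale property; subtracting the conditional mean restores it for
  -- `d`, and `r` collects the rest.
  set d : ℕ → Ω → ℝ := fun i ω => w i * (A i ω - (μ[A i | 𝒢 i]) ω) with hd
  set r : ℕ → Ω → ℝ := fun i ω => D i ω - A i ω - (μ[D i - A i | 𝒢 i]) ω with hr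
  have hcA : ∀ i, StronglyMeasurable[𝒢 i] (μ[A i | 𝒢 i]) := fun i => stronglyMeasurable_condExp
  have hdm : ∀ i, StronglyMeasurable[𝒢 (i + 1)] (d i) := fun i =>
    ((hAm i).sub ((hcA i).mono (𝒢.mono (Nat.le_succ i)))).const_mul (w i)
  have hAc : ∀ i, MemLp (fun ω => A i ω - (μ[A i | 𝒢 i]) ω) 2 μ := fun i =>
    (hAL2 i).sub ((hAL2 i).condExp one_le_two)
  have hdL2 : ∀ i, MemLp (d i) 2 μ := fun i => (hAc i).const_mul (w i)
  have hAint : ∀ i, Integrable (A i) μ := fun i => (hAL2 i).integrable one_le_two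
  have hdcond : ∀ i, μ[d i | 𝒢 i] =ᵐ[μ] 0 := by
    intro i
    have h1 := condExp_sub (hAint i) (integrable_condExp (f := A i) (m := 𝒢 i)) (𝒢 i)
    rw [condExp_of_stronglyMeasurable (𝒢.le i) (hcA i) integrable_condExp] at h1
    have h2 : μ[w i • (A i - μ[A i | 𝒢 i]) | 𝒢 i] =ᵐ[μ] w i • μ[A i - μ[A i | 𝒢 i] | 𝒢 i] :=
      condExp_smul _ _ _
    refine EventuallyEq.trans h2 ?_
    filter_upwards [h1] with ω h
    simp [h]
  have hrint : ∀ i, Integrable (r i) μ := fun i =>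
    ((hDint i).sub (hAint i)).sub integrable_condExp
  -- the decomposition of `D i / (i + 1)`
  have hdec : ∀ i, ∀ᵐ ω ∂μ, D i ω / ((i : ℝ) + 1) = d i ω + w i * r i ω := by
    intro i
    filter_upwards [condExp_sub (hDint i) (hAint i) (𝒢 i), hcond i] with ω h1 h2
    have h3 : (μ[D i - A i | 𝒢 i]) ω = - (μ[A i | 𝒢 i]) ω := by
      rw [h1, Pi.sub_apply, h2, Pi.zero_apply, zero_sub]
    simp only [hd, hr, h3, hw, div_eq_inv_mul]
    ring
  set M : ℕ → Ω → ℝ := fun n ω => ∑ i ∈ Finset.range n, D i ω / ((i : ℝ) + 1) with hM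
  have hDwint : ∀ i, Integrable (fun ω => D i ω / ((i : ℝ) + 1)) μ := fun i => (hDint i).div_const _
  have hMint : ∀ n, Integrable (M n) μ := fun n => integrable_finsetSum _ fun i _ => hDwint i
  have hmart : Martingale M 𝒢 μ := by
    refine martingale_of_condExp_sub_eq_zero_nat (fun n => ?_) hMint fun n => ?_
    · refine Finset.stronglyMeasurable_fun_sum _ fun i hi => ?_
      have : StronglyMeasurable[𝒢 (i + 1)] (fun ω => D i ω / ((i : ℝ) + 1)) := by
        simp_rw [div_eq_mul_inv]
        exact (hmeas i).mul_const _
      exact this.mono (𝒢.mono (Finset.mem_range.1 hi))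
    · have e : M (n + 1) - M n = w n • D n := by
        ext ω
        simp only [hM, Finset.sum_range_succ, Pi.sub_apply, Pi.smul_apply, smul_eq_mul, hw]
        rw [add_sub_cancel_left, div_eq_inv_mul]
      rw [e]
      refine EventuallyEq.trans (condExp_smul _ _ _) ?_
      filter_upwards [hcond n] with ω h
      simp [h]
  -- the `L¹` bound
  have hsum : Summable fun i : ℕ => ((i : ℝ) + 1) ^ (-p) := by
    have := (summable_nat_add_iff 1).2 (Real.summable_nat_rpow.2 (by linarith : -p < -1))
    simpa using this
  set T := ∑' i : ℕ, ((i : ℝ) + 1) ^ (-p) with hT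
  have hdsq : ∀ i, ∫ ω, d i ω ^ 2 ∂μ ≤ ((i : ℝ) + 1) ^ (-p) * C := by
    intro i
    have h1 : ∫ ω, d i ω ^ 2 ∂μ = w i ^ 2 * ∫ ω, (A i ω - (μ[A i | 𝒢 i]) ω) ^ 2 ∂μ := by
      rw [← integral_const_mul]
      simp only [hd, mul_pow]
    have h2 := (integral_sq_sub_condExp_le (𝒢.le i) (hAL2 i)).trans
      (truncation_bounds (hwpos i) hp hp2 (hpint i) (hC i)).1
    rw [h1]
    refine (mul_le_mul_of_nonneg_left h2 (sq_nonneg _)).trans (le_of_eq ?_)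
    have h3 : w i ^ 2 = ((i : ℝ) + 1) ^ (-2 : ℝ) := by
      rw [Real.rpow_neg (hwpos i).le, hw]
      simp
    rw [h3, ← mul_assoc, ← Real.rpow_add (hwpos i)]
    congr 2
    ring
  -- The factor 2 pays for the conditional mean, an `L¹` contraction of `D i - A i`.
  have hrabs : ∀ i, ∫ ω, |w i * r i ω| ∂μ ≤ 2 * (((i : ℝ) + 1) ^ (-p) * C) := by
    intro i
    have h1 : ∫ ω, |w i * r i ω| ∂μ = w i * ∫ ω, |r i ω| ∂μ := by
      rw [← integral_const_mul]
      simp only [abs_mul, abs_of_nonneg (hw0 i)]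
    have h2 : ∫ ω, |r i ω| ∂μ ≤ ∫ ω, |D i ω - A i ω| ∂μ + ∫ ω, |D i ω - A i ω| ∂μ := by
      have hDA : Integrable (D i - A i) μ := (hDint i).sub (hAint i)
      calc ∫ ω, |r i ω| ∂μ
          ≤ ∫ ω, (|D i ω - A i ω| + |(μ[D i - A i | 𝒢 i]) ω|) ∂μ :=
            integral_mono (hrint i).abs (hDA.abs.add integrable_condExp.abs)
              fun ω => abs_sub _ _
        _ = ∫ ω, |D i ω - A i ω| ∂μ + ∫ ω, |(μ[D i - A i | 𝒢 i]) ω| ∂μ :=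
            integral_add hDA.abs integrable_condExp.abs
        _ ≤ _ := by
            have := integral_norm_condExp_le (μ := μ) (m := 𝒢 i) (D i - A i)
            simp only [Real.norm_eq_abs, Pi.sub_apply] at this
            linarith
    have h3 := (truncation_bounds (hwpos i) hp hp2 (hpint i) (hC i)).2
    have h4 : w i * (((i : ℝ) + 1) ^ (1 - p) * C) = ((i : ℝ) + 1) ^ (-p) * C := by
      have : w i = ((i : ℝ) + 1) ^ (-1 : ℝ) := by rw [Real.rpow_neg_one]
      rw [this, ← mul_assoc, ← Real.rpow_add (hwpos i)]
      congr 2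
      ring
    rw [h1, ← h4]
    nlinarith [mul_le_mul_of_nonneg_left (h2.trans (add_le_add h3 h3)) (hw0 i)]
  -- The `L²` part enters through `|y| ≤ 1 + y ^ 2`, orthogonality of the increments turning the
  -- square of the sum into a sum of squares.
  have hbound : ∀ n, ∫ ω, |M n ω| ∂μ ≤ 1 + T * C + 2 * (T * C) := by
    intro n
    have hpart : ∑ i ∈ Finset.range n, ((i : ℝ) + 1) ^ (-p) * C ≤ T * C := by
      rw [← Finset.sum_mul]
      refine mul_le_mul_of_nonneg_right (hsum.sum_le_tsum _ fun i _ => ?_) hC0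
      exact Real.rpow_nonneg (hwpos i).le _
    have hSL2 : MemLp (fun ω => ∑ i ∈ Finset.range n, d i ω) 2 μ :=
      memLp_finsetSum _ fun i _ => hdL2 i
    have hwr : ∀ i, Integrable (fun ω => |w i * r i ω|) μ := fun i =>
      ((hrint i).const_mul (w i)).abs
    calc ∫ ω, |M n ω| ∂μ
        ≤ ∫ ω, (1 + (∑ i ∈ Finset.range n, d i ω) ^ 2
            + ∑ i ∈ Finset.range n, |w i * r i ω|) ∂μ := by
          refine integral_mono_ae (hMint n).abs
            (((integrable_const 1).add hSL2.integrable_sq).add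
              (integrable_finsetSum _ fun i _ => hwr i)) ?_
          filter_upwards [ae_all_iff.2 hdec] with ω hω
          have e : M n ω = ∑ i ∈ Finset.range n, d i ω + ∑ i ∈ Finset.range n, w i * r i ω := by
            rw [← Finset.sum_add_distrib]
            exact Finset.sum_congr rfl fun i _ => hω i
          rw [e]
          refine (abs_add_le _ _).trans (add_le_add ?_ (Finset.abs_sum_le_sum_abs _ _))
          rw [abs_le]
          constructor <;> nlinarith [sq_nonneg (∑ i ∈ Finset.range n, d i ω + 1),
            sq_nonneg (∑ i ∈ Finset.range n, d i ω - 1)]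
      _ = 1 + ∑ i ∈ Finset.range n, ∫ ω, d i ω ^ 2 ∂μ
            + ∑ i ∈ Finset.range n, ∫ ω, |w i * r i ω| ∂μ := by
          have i1 : Integrable (fun ω => 1 + (∑ i ∈ Finset.range n, d i ω) ^ 2) μ :=
            (integrable_const 1).add hSL2.integrable_sq
          rw [integral_add i1 (integrable_finsetSum _ fun i _ => hwr i),
            integral_add (integrable_const 1) hSL2.integrable_sq,
            integral_finsetSum _ fun i _ => hwr i,
            integral_sq_sum hdm hdL2 hdcond n]
          simp
      _ ≤ 1 + ∑ i ∈ Finset.range n, ((i : ℝ) + 1) ^ (-p) * C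
            + ∑ i ∈ Finset.range n, 2 * (((i : ℝ) + 1) ^ (-p) * C) := by
          gcongr with i hi i hi
          · exact hdsq i
          · exact hrabs i
      _ ≤ _ := by
          rw [← Finset.mul_sum]
          linarith
  have hconv := hmart.submartingale.exists_ae_tendsto_of_bdd
    (R := (1 + T * C + 2 * (T * C)).toNNReal) fun n => by
      rw [eLpNorm_one_eq_lintegral_enorm, ← ofReal_integral_norm_eq_lintegral_enorm (hMint n)]
      exact ENNReal.ofReal_le_ofReal (hbound n)
  filter_upwards [hconv] with ω hω
  obtain ⟨c, hc⟩ := hω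
  exact HasMean.of_tendsto_sum_div hc

/-- **Strong law of large numbers** for martingale differences bounded in `L^p`, `1 < p ≤ 2`. -/
theorem ae_hasMean_zero {𝒢 : Filtration ℕ mΩ} {D : ℕ → Ω → ℝ} {p C : ℝ}
    (hmeas : ∀ i, AEStronglyMeasurable[𝒢 (i + 1)] (D i) μ) (hDint : ∀ i, Integrable (D i) μ)
    (hcond : ∀ i, μ[D i | 𝒢 i] =ᵐ[μ] 0) (hp : 1 < p) (hp2 : p ≤ 2)
    (hpint : ∀ i, Integrable (fun ω => |D i ω| ^ p) μ)
    (hC : ∀ i, ∫ ω, |D i ω| ^ p ∂μ ≤ C) :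
    ∀ᵐ ω ∂μ, HasMean (fun i => D i ω) 0 := by
  choose E hE hae using hmeas
  have hae' : ∀ i, (fun ω => |D i ω| ^ p) =ᵐ[μ] fun ω => |E i ω| ^ p := fun i => by
    filter_upwards [hae i] with ω h
    rw [h]
  have := ae_hasMean_zero_of_stronglyMeasurable (μ := μ) (𝒢 := 𝒢) (D := E)
    hE (fun i => (hDint i).congr (hae i))
    (fun i => (condExp_congr_ae (hae i).symm).trans (hcond i)) hp hp2
    (fun i => (hpint i).congr (hae' i))
    (fun i => (integral_congr_ae (hae' i)).symm.le.trans (hC i))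
  filter_upwards [this, ae_all_iff.2 hae] with ω h1 h2
  exact h1.congr fun i => (h2 i).symm

end SLLN

/-! ### Stable autoregressive recursions -/

section Stability

attribute [local instance] Matrix.linftyOpNormedRing Matrix.linftyOpNormedAlgebra

variable {q : ℕ} {a : Fin q → ℝ}

/-- The transition matrix of the lag vectors: `𝐱_{t+1}(q) = Φ 𝐱_t(q) + ε_{t+1} e₀`. -/
noncomputable def transition (a : Fin q → ℝ) : Matrix (Fin q) (Fin q) ℝ := (companion a).transpose

theorem transition_apply (i j : Fin q) :
    transition a i j = if (i : ℕ) = 0 then a j else if (i : ℕ) = (j : ℕ) + 1 then 1 else 0 := rfl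

/-- The shift rows force an eigenvector for `k ≠ 0` to be the geometric sequence `k⁻¹ ^ n`, and the
first row then says that `k⁻¹` is a zero of `1 - a₁ z - ⋯ - a_q z ^ q`. Such a zero lies outside the
closed disc. -/
theorem transition_eigenvalue_norm_lt_one
    (ha : ∀ z : ℂ, ‖z‖ ≤ 1 → 1 - ∑ i : Fin q, (a i : ℂ) * z ^ ((i : ℕ) + 1) ≠ 0)
    {k : ℂ} (hk : k ∈ spectrum ℂ ((transition a).map Complex.ofReal)) : ‖k‖ < 1 := by
  by_contra hlt
  push Not at hlt
  have hk0 : k ≠ 0 := by rintro rfl; simp at hlt; linarith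
  rw [← Matrix.spectrum_toLin', ← Module.End.hasEigenvalue_iff_mem_spectrum] at hk
  obtain ⟨v, hv⟩ := hk.exists_hasEigenvector
  have hv0 := hv.2
  have hev : ∀ i, ∑ j, ((transition a i j : ℝ) : ℂ) * v j = k * v i := fun i => by
    have := congrFun hv.apply_eq_smul i
    simpa [Matrix.toLin'_apply, Matrix.mulVec, dotProduct] using this
  -- the eigenvector is a geometric sequence
  have hgeom : ∀ n : ℕ, ∀ hn : n < q, v ⟨n, hn⟩ = k⁻¹ ^ n * v ⟨0, by omega⟩ := by
    intro n
    induction n with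
    | zero => intro hn; simp
    | succ n ih =>
      intro hn
      have h1 := hev ⟨n + 1, hn⟩
      rw [Finset.sum_eq_single (⟨n, by omega⟩ : Fin q)] at h1
      · rw [transition_apply] at h1
        simp only [Nat.add_eq_zero_iff, one_ne_zero, and_false, if_false, if_true,
          Complex.ofReal_one, one_mul] at h1
        rw [ih (by omega)] at h1
        rw [pow_succ, mul_comm (k⁻¹ ^ n), mul_assoc, h1, inv_mul_cancel_left₀ hk0]
      · intro j _ hj
        rw [transition_apply]
        have : n ≠ (j : ℕ) := fun h => hj (Fin.ext h.symm)
        simp [this]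
      · simp
  obtain ⟨i, hi⟩ := Function.ne_iff.1 hv0
  have hq : 0 < q := i.pos
  have hv00 : v ⟨0, hq⟩ ≠ 0 := by
    intro h
    apply hi
    have := hgeom i i.2
    rw [h, mul_zero] at this
    simpa using this
  have h0 := hev ⟨0, hq⟩
  refine ha k⁻¹ (by rw [norm_inv]; exact inv_le_one_of_one_le₀ hlt) ?_
  have h1 : ∑ j, ((transition a ⟨0, hq⟩ j : ℝ) : ℂ) * v j
      = (∑ j : Fin q, (a j : ℂ) * k⁻¹ ^ (j : ℕ)) * v ⟨0, hq⟩ := by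
    rw [Finset.sum_mul]
    refine Finset.sum_congr rfl fun j _ => ?_
    rw [transition_apply, if_pos rfl, hgeom j j.2]
    ring
  rw [h1] at h0
  have h2 := mul_right_cancel₀ hv00 h0
  have h3 : ∑ i : Fin q, (a i : ℂ) * k⁻¹ ^ ((i : ℕ) + 1)
      = k⁻¹ * ∑ j : Fin q, (a j : ℂ) * k⁻¹ ^ (j : ℕ) := by
    rw [Finset.mul_sum]
    exact Finset.sum_congr rfl fun j _ => by ring
  rw [h3, h2, inv_mul_cancel₀ hk0, sub_self]

theorem norm_entry_le_linftyOpNorm (A : Matrix (Fin q) (Fin q) ℂ) (i j : Fin q) :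
    ‖A i j‖ ≤ ‖A‖ := by
  rw [← coe_nnnorm, ← coe_nnnorm, NNReal.coe_le_coe, Matrix.linfty_opNNNorm_def]
  refine le_trans ?_ (Finset.le_sup (f := fun i => ∑ j, ‖A i j‖₊) (Finset.mem_univ i))
  exact Finset.single_le_sum (f := fun j => ‖A i j‖₊) (fun _ _ => zero_le) (Finset.mem_univ j)

/-- Geometric decay of the powers of the transition matrix. -/
theorem exists_transition_pow_le
    (ha : ∀ z : ℂ, ‖z‖ ≤ 1 → 1 - ∑ i : Fin q, (a i : ℂ) * z ^ ((i : ℕ) + 1) ≠ 0) :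
    ∃ C r : ℝ, 0 < C ∧ 0 < r ∧ r < 1 ∧ ∀ n i j, |(transition a ^ n) i j| ≤ C * r ^ n := by
  rcases Nat.eq_zero_or_pos q with rfl | hq
  · exact ⟨1, 1 / 2, by norm_num, by norm_num, by norm_num, fun n i => i.elim0⟩
  have : Nonempty (Fin q) := ⟨⟨0, hq⟩⟩
  set B : Matrix (Fin q) (Fin q) ℂ := (transition a).map Complex.ofReal with hB
  have hrad : spectralRadius ℂ B < (1 : NNReal) :=
    spectrum.spectralRadius_lt_of_forall_lt B fun k hk =>
      NNReal.coe_lt_coe.1 (by simpa using transition_eigenvalue_norm_lt_one ha hk)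
  obtain ⟨r, hr1, hr2⟩ := ENNReal.lt_iff_exists_nnreal_btwn.1 hrad
  have hr0 : 0 < r := by
    have : (0 : ENNReal) < r := lt_of_le_of_lt zero_le hr1
    exact_mod_cast this
  have hr2' : (r : ℝ) < 1 := by exact_mod_cast hr2
  -- Gelfand's formula: any `r` strictly between the spectral radius and 1 eventually dominates `‖B
  -- ^ n‖` by `r ^ n`; the constant `C` then absorbs the first finitely many powers.
  have hlim := spectrum.pow_nnnorm_pow_one_div_tendsto_nhds_spectralRadius B
  have hev : ∀ᶠ n : ℕ in atTop, ‖B ^ n‖ ≤ 1 * ‖(r : ℝ) ^ n‖ := by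
    filter_upwards [hlim.eventually_lt_const hr1, eventually_gt_atTop 0] with n hn hn0
    have hn' : (n : ℝ) ≠ 0 := by positivity
    have h1 : ((‖B ^ n‖₊ : ENNReal) ^ (1 / n : ℝ)) ^ (n : ℝ) ≤ (r : ENNReal) ^ (n : ℝ) :=
      ENNReal.rpow_le_rpow hn.le (Nat.cast_nonneg n)
    rw [← ENNReal.rpow_mul, one_div, inv_mul_cancel₀ hn', ENNReal.rpow_one,
      ENNReal.rpow_natCast] at h1
    have h2 : ‖B ^ n‖₊ ≤ r ^ n := by exact_mod_cast h1
    rw [one_mul, Real.norm_of_nonneg (by positivity)]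
    exact_mod_cast h2
  obtain ⟨C, hC, hbd⟩ := Asymptotics.bound_of_isBigO_nat_atTop
    (Asymptotics.IsBigO.of_bound 1 hev)
  refine ⟨C, r, hC, hr0, hr2', fun n i j => ?_⟩
  have h1 := hbd (x := n) (by positivity)
  rw [Real.norm_of_nonneg (by positivity)] at h1
  refine le_trans ?_ h1
  refine le_trans (le_of_eq ?_) (norm_entry_le_linftyOpNorm (B ^ n) i j)
  have : B ^ n = (transition a ^ n).map Complex.ofReal := by
    have := map_pow (Complex.ofRealHom.mapMatrix (m := Fin q)) (transition a) n
    exact this.symm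
  rw [this, Matrix.map_apply, Complex.norm_real, Real.norm_eq_abs]

/-- The only solution of the homogeneous discrete Lyapunov equation is zero. -/
theorem eq_zero_of_transition_conj
    (ha : ∀ z : ℂ, ‖z‖ ≤ 1 → 1 - ∑ i : Fin q, (a i : ℂ) * z ^ ((i : ℕ) + 1) ≠ 0)
    {G : Matrix (Fin q) (Fin q) ℝ} (hG : G = transition a * G * (transition a).transpose) :
    G = 0 := by
  obtain ⟨C, r, hC, hr0, hr1, hbd⟩ := exists_transition_pow_le ha
  have hpow : ∀ n : ℕ, G = transition a ^ n * G * (transition a ^ n).transpose := by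
    intro n
    induction n with
    | zero => simp
    | succ n ih =>
      conv_lhs => rw [ih, hG]
      rw [pow_succ, Matrix.transpose_mul]
      simp only [Matrix.mul_assoc]
  ext i j
  have hle : ∀ n : ℕ, |G i j| ≤ (C ^ 2 * ∑ k, ∑ l, |G l k|) * (r ^ 2) ^ n := by
    intro n
    conv_lhs => rw [hpow n]
    rw [Matrix.mul_apply]
    simp only [Matrix.mul_apply, Matrix.transpose_apply]
    refine (Finset.abs_sum_le_sum_abs _ _).trans ?_
    rw [mul_assoc, Finset.sum_mul, Finset.mul_sum]
    refine Finset.sum_le_sum fun k _ => ?_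
    rw [Finset.sum_mul, Finset.sum_mul, Finset.mul_sum]
    refine (Finset.abs_sum_le_sum_abs _ _).trans ?_
    refine Finset.sum_le_sum fun l _ => ?_
    rw [abs_mul, abs_mul]
    calc |(transition a ^ n) i l| * |G l k| * |(transition a ^ n) j k|
        ≤ (C * r ^ n) * |G l k| * (C * r ^ n) := by
          gcongr
          · exact hbd n i l
          · exact hbd n j k
      _ = C ^ 2 * (|G l k| * (r ^ 2) ^ n) := by ring
  have hlim : Tendsto (fun n : ℕ => (C ^ 2 * ∑ k, ∑ l, |G l k|) * (r ^ 2) ^ n) atTop (𝓝 0) := by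
    have := (tendsto_pow_atTop_nhds_zero_of_lt_one (by positivity)
      (by nlinarith : r ^ 2 < 1)).const_mul (C ^ 2 * ∑ k, ∑ l, |G l k|)
    rwa [mul_zero] at this
  have := ge_of_tendsto' hlim hle
  simpa using abs_nonpos_iff.1 this

theorem transition_mulVec_lagVec {u e : ℤ → ℝ}
    (hu : ∀ t : ℤ, u (t + 1) = ∑ i : Fin q, a i * u (t - ((i : ℕ) : ℤ)) + e (t + 1))
    (t : ℤ) (i : Fin q) :
    (Matrix.mulVec (transition a) (lagVec u q t)) i
      = lagVec u q (t + 1) i - if (i : ℕ) = 0 then e (t + 1) else 0 := by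
  simp only [Matrix.mulVec, dotProduct, lagVec, transition_apply]
  by_cases hi : (i : ℕ) = 0
  · simp only [hi, if_true]
    rw [Nat.cast_zero, sub_zero, hu t]
    ring
  · simp only [hi, if_false, sub_zero]
    have hi' := i.2
    rw [Finset.sum_eq_single (⟨(i : ℕ) - 1, by omega⟩ : Fin q)]
    · have h1 : (i : ℕ) = (i : ℕ) - 1 + 1 := by omega
      rw [if_pos h1, one_mul]
      congr 1
      simp only
      omega
    · intro j _ hj
      have : ¬ ((i : ℕ) = (j : ℕ) + 1) := fun h => hj (Fin.ext (by simp; omega))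
      simp [this]
    · simp

/-- Iterating a stable recursion: the influence of the initial values and of the noise decays
geometrically. -/
theorem exists_recursion_expansion (hq : 0 < q)
    (ha : ∀ z : ℂ, ‖z‖ ≤ 1 → 1 - ∑ i : Fin q, (a i : ℂ) * z ^ ((i : ℕ) + 1) ≠ 0) :
    ∃ (C r : ℝ) (κ : ℕ → Fin q → ℝ) (ψ : ℕ → ℝ), 0 < C ∧ 0 < r ∧ r < 1 ∧
      (∀ n i, |κ n i| ≤ C * r ^ n) ∧ (∀ n, |ψ n| ≤ C * r ^ n) ∧
      ∀ u e : ℤ → ℝ,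
        (∀ t : ℤ, u (t + 1) = ∑ i : Fin q, a i * u (t - ((i : ℕ) : ℤ)) + e (t + 1)) →
        ∀ (t : ℤ) (n : ℕ), u (t + n) = ∑ i, κ n i * u (t - ((i : ℕ) : ℤ))
          + ∑ j ∈ Finset.range n, ψ j * e (t + n - j) := by
  obtain ⟨C, r, hC, hr0, hr1, hbd⟩ := exists_transition_pow_le ha
  refine ⟨C, r, fun n i => (transition a ^ n) ⟨0, hq⟩ i,
    fun n => (transition a ^ n) ⟨0, hq⟩ ⟨0, hq⟩, hC, hr0, hr1, fun n i => hbd n _ i,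
    fun n => hbd n _ _, fun u e hu t n => ?_⟩
  -- The induction must carry the whole lag vector; the claim is its coordinate 0.
  have key : ∀ (n : ℕ) (i : Fin q), lagVec u q (t + n) i
      = (Matrix.mulVec (transition a ^ n) (lagVec u q t)) i
        + ∑ j ∈ Finset.range n, (transition a ^ j) i ⟨0, hq⟩ * e (t + n - j) := by
    intro n
    induction n with
    | zero => intro i; simp
    | succ n ih =>
      intro i
      have h1 := transition_mulVec_lagVec hu (t + n) i
      have h2 : lagVec u q (t + n) = Matrix.mulVec (transition a ^ n) (lagVec u q t)
        + ∑ j ∈ Finset.range n, e (t + n - j) • (transition a ^ j).col ⟨0, hq⟩ := by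
        ext i
        rw [ih i, Pi.add_apply, Finset.sum_apply]
        congr 1
        exact Finset.sum_congr rfl fun j _ => by
          simp [Matrix.col_apply, mul_comm]
      rw [h2, Matrix.mulVec_add, Matrix.mulVec_mulVec, ← pow_succ', Matrix.mulVec_sum,
        Pi.add_apply, Finset.sum_apply] at h1
      have h3 : (t + ((n + 1 : ℕ) : ℤ)) = t + n + 1 := by push_cast; ring
      rw [h3, Finset.sum_range_succ']
      have h4 : lagVec u q (t + n + 1) i = _ := (sub_eq_iff_eq_add.1 h1.symm)
      rw [h4, add_assoc]
      congr 1
      congr 1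
      · refine Finset.sum_congr rfl fun j _ => ?_
        rw [Matrix.mulVec_smul, Pi.smul_apply, smul_eq_mul, pow_succ', mul_comm]
        congr 1
        congr 1
        push_cast
        ring
      · rw [pow_zero, Matrix.one_apply]
        by_cases hi : (i : ℕ) = 0
        · have : i = ⟨0, hq⟩ := Fin.ext hi
          simp [this]
        · have : i ≠ ⟨0, hq⟩ := fun h => hi (congrArg Fin.val h)
          simp [hi, this]
  have := key n ⟨0, hq⟩
  simpa [lagVec, Matrix.mulVec, dotProduct] using this

/-- If the noise is `o(√n)` along a path, then so is the solution of a stable recursion. -/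
theorem tendsto_sq_div_of_noise (hq : 0 < q)
    (ha : ∀ z : ℂ, ‖z‖ ≤ 1 → 1 - ∑ i : Fin q, (a i : ℂ) * z ^ ((i : ℕ) + 1) ≠ 0)
    {u e : ℤ → ℝ}
    (hu : ∀ t : ℤ, u (t + 1) = ∑ i : Fin q, a i * u (t - ((i : ℕ) : ℤ)) + e (t + 1))
    (he : Tendsto (fun n : ℕ => e n ^ 2 / (n : ℝ)) atTop (𝓝 0)) :
    Tendsto (fun n : ℕ => u n ^ 2 / (n : ℝ)) atTop (𝓝 0) := by
  obtain ⟨C, r, κ, ψ, hC, hr0, hr1, hκ, hψ, hexp⟩ := exists_recursion_expansion hq ha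
  set g : ℕ → ℝ := fun n => |e n| / √(n : ℝ) with hg
  have hg0 : Tendsto g atTop (𝓝 0) := by
    have := he.sqrt
    rw [Real.sqrt_zero] at this
    refine this.congr fun n => ?_
    rw [Real.sqrt_div (sq_nonneg _), Real.sqrt_sq_eq_abs]
  obtain ⟨B, hB⟩ : ∃ B, ∀ n, g n ≤ B := by
    obtain ⟨B, hB⟩ := hg0.bddAbove_range
    exact ⟨B, fun n => hB ⟨n, rfl⟩⟩
  have hgn : ∀ n, 0 ≤ g n := fun n => by positivity
  -- A convolution of the null sequence `g` with geometric weights; it tends to zero by dominated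
  -- convergence for series, with bound `C r ^ j B`. The true weights involve `√n` instead of `√(n -
  -- j)`, which only helps.
  set F : ℕ → ℕ → ℝ := fun n j => if j < n then C * r ^ j * g (n - j) else 0 with hF
  have hF0 : Tendsto (fun n => ∑' j, F n j) atTop (𝓝 (∑' _ : ℕ, (0 : ℝ))) := by
    refine tendsto_tsum_of_dominated_convergence (bound := fun j => C * r ^ j * B) ?_ ?_ ?_
    · exact ((summable_geometric_of_lt_one hr0.le hr1).mul_left C).mul_right B
    · intro j
      have h1 : Tendsto (fun n : ℕ => C * r ^ j * g (n - j)) atTop (𝓝 (C * r ^ j * 0)) :=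
        (hg0.comp (tendsto_sub_atTop_nat j)).const_mul _
      rw [mul_zero] at h1
      refine h1.congr' ?_
      filter_upwards [eventually_gt_atTop j] with n hn
      simp [hF, hn]
    · refine Eventually.of_forall fun n j => ?_
      have hB0 : 0 ≤ B := (hgn 0).trans (hB 0)
      by_cases h : j < n
      · simp only [hF, h, if_true]
        rw [Real.norm_of_nonneg (by have := hgn (n - j); positivity)]
        gcongr
        exact hB _
      · simp only [hF, h, if_false, norm_zero]
        positivity
  rw [tsum_zero] at hF0
  have hI : Tendsto (fun n : ℕ => (C * ∑ i : Fin q, |u (0 - ((i : ℕ) : ℤ))|) * r ^ n) atTop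
      (𝓝 0) := by
    have := (tendsto_pow_atTop_nhds_zero_of_lt_one hr0.le hr1).const_mul
      (C * ∑ i : Fin q, |u (0 - ((i : ℕ) : ℤ))|)
    rwa [mul_zero] at this
  have hsum := (hI.add hF0).pow 2
  rw [add_zero, zero_pow two_ne_zero] at hsum
  refine squeeze_zero' (Eventually.of_forall fun n => by positivity) ?_ hsum
  filter_upwards [eventually_gt_atTop 0] with n hn
  have hn1 : (1 : ℝ) ≤ √(n : ℝ) := by
    rw [Real.one_le_sqrt]
    exact_mod_cast hn
  have hsn : 0 < √(n : ℝ) := by linarith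
  have h1 : u n ^ 2 / (n : ℝ) = (|u n| / √(n : ℝ)) ^ 2 := by
    rw [div_pow, sq_abs, Real.sq_sqrt (Nat.cast_nonneg n)]
  rw [h1]
  refine pow_le_pow_left₀ (by positivity) ?_ 2
  have h2 := hexp u e hu 0 n
  rw [zero_add] at h2
  rw [h2]
  refine (div_le_div_of_nonneg_right (abs_add_le _ _) hsn.le).trans ?_
  rw [add_div]
  refine add_le_add ?_ ?_
  · refine (div_le_self (abs_nonneg _) hn1).trans ?_
    refine (Finset.abs_sum_le_sum_abs _ _).trans ?_
    rw [mul_assoc, Finset.sum_mul, Finset.mul_sum]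
    refine Finset.sum_le_sum fun i _ => ?_
    rw [abs_mul]
    calc |κ n i| * |u (0 - ((i : ℕ) : ℤ))| ≤ (C * r ^ n) * |u (0 - ((i : ℕ) : ℤ))| := by
          gcongr; exact hκ n i
      _ = _ := by ring
  · have h3 : ∑' j, F n j = ∑ j ∈ Finset.range n, F n j :=
      tsum_eq_sum fun j hj => by
        have : ¬ j < n := by simpa using hj
        simp [hF, this]
    rw [h3, div_le_iff₀ hsn, Finset.sum_mul]
    refine (Finset.abs_sum_le_sum_abs _ _).trans (Finset.sum_le_sum fun j hj => ?_)
    have hj' := Finset.mem_range.1 hj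
    have hcast : ((n : ℤ) - (j : ℤ)) = ((n - j : ℕ) : ℤ) := by omega
    have hnj : 0 < √((n - j : ℕ) : ℝ) := Real.sqrt_pos.2 (by exact_mod_cast Nat.sub_pos_of_lt hj')
    have h4 : |e ((n : ℤ) - j)| = g (n - j) * √((n - j : ℕ) : ℝ) := by
      rw [hcast, hg]
      exact (div_mul_cancel₀ _ hnj.ne').symm
    have h5 : √((n - j : ℕ) : ℝ) ≤ √(n : ℝ) :=
      Real.sqrt_le_sqrt (by exact_mod_cast Nat.sub_le n j)
    rw [abs_mul, h4]
    simp only [hF, hj', if_true]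
    rw [← mul_assoc]
    have := hgn (n - j)
    gcongr
    exact hψ j

end Stability

/-! ### The noise -/

theorem IsMartingaleNoise.measurable {Ω : Type*} {mΩ : MeasurableSpace Ω} {μ : Measure Ω}
    {ℱ : Filtration ℤ mΩ} {σ α : ℝ} {ε : ℤ → Ω → ℝ} (hε : IsMartingaleNoise μ ℱ σ α ε) (t : ℤ) :
    Measurable (ε t) :=
  (hε.adapted t).mono (ℱ.le t) le_rfl

section Noise

variable {Ω : Type*} {mΩ : MeasurableSpace Ω} {μ : Measure Ω}

/-- A variable `g ≥ 0` with constant conditional mean `c` given `m` is, in the mean, uncorrelated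
with every nonnegative `m`-measurable variable, without integrability assumptions. -/
theorem lintegral_mul_of_setLIntegral {m : MeasurableSpace Ω} (hm : m ≤ mΩ) {f g : Ω → ENNReal}
    {c : ENNReal} (hf : Measurable[m] f) (hg : Measurable[mΩ] g)
    (h : ∀ A, MeasurableSet[m] A → ∫⁻ ω in A, g ω ∂μ = c * μ A) :
    ∫⁻ ω, f ω * g ω ∂μ = c * ∫⁻ ω, f ω ∂μ := by
  -- The hypothesis says that `g μ` and `c μ` agree on `m`, so they integrate `m`-measurable
  -- functions alike.
  have htrim : (μ.withDensity g).trim hm = (c • μ).trim hm := by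
    refine Measure.ext fun A hA => ?_
    rw [trim_measurableSet_eq hm hA, trim_measurableSet_eq hm hA, withDensity_apply _ (hm A hA),
      h A hA]
    rfl
  have h1 : ∫⁻ ω, f ω ∂(μ.withDensity g) = ∫⁻ ω, f ω ∂(c • μ) := by
    rw [← lintegral_trim hm hf, htrim, lintegral_trim hm hf]
  rw [lintegral_withDensity_eq_lintegral_mul _ hg (hf.mono hm le_rfl), lintegral_smul_measure] at h1
  rw [smul_eq_mul] at h1
  rw [← h1]
  exact lintegral_congr fun ω => mul_comm _ _

variable [IsProbabilityMeasure μ]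

namespace IsMartingaleNoise

variable {ℱ : Filtration ℤ mΩ} {σ α : ℝ} {ε : ℤ → Ω → ℝ}

theorem integrable (hε : IsMartingaleNoise μ ℱ σ α ε) (t : ℤ) : Integrable (ε t) μ :=
  (hε.memLp t).integrable one_le_two

theorem integral_eq_zero (hε : IsMartingaleNoise μ ℱ σ α ε) (t : ℤ) : ∫ ω, ε t ω ∂μ = 0 := by
  rw [← integral_condExp (ℱ.le (t - 1)), integral_congr_ae (hε.condMean t)]
  simp

theorem integral_sq (hε : IsMartingaleNoise μ ℱ σ α ε) (t : ℤ) :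
    ∫ ω, ε t ω ^ 2 ∂μ = σ ^ 2 := by
  rw [← integral_condExp (ℱ.le (t - 1)), integral_congr_ae (hε.condVar t)]
  simp

theorem integral_mul_eq_zero (hε : IsMartingaleNoise μ ℱ σ α ε) {t : ℤ} {f : Ω → ℝ}
    (hf : AEStronglyMeasurable[ℱ (t - 1)] f μ) (hf2 : MemLp f 2 μ) :
    ∫ ω, f ω * ε t ω ∂μ = 0 :=
  integral_mul_eq_zero_of_condExp_eq_zero (ℱ.le _) hf (hf2.integrable_mul (hε.memLp t))
    (hε.integrable t) (hε.condMean t)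

theorem condExp_mul_eq_zero (hε : IsMartingaleNoise μ ℱ σ α ε) {t : ℤ} {f : Ω → ℝ}
    (hf : AEStronglyMeasurable[ℱ (t - 1)] f μ) (hf2 : MemLp f 2 μ) :
    μ[f * ε t | ℱ (t - 1)] =ᵐ[μ] 0 := by
  filter_upwards [condExp_mul_of_aestronglyMeasurable_left hf (hf2.integrable_mul (hε.memLp t))
    (hε.integrable t), hε.condMean t] with ω h1 h2
  rw [h1, Pi.mul_apply, h2, Pi.zero_apply, mul_zero]

theorem setLIntegral_sq (hε : IsMartingaleNoise μ ℱ σ α ε) (t : ℤ) {A : Set Ω}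
    (hA : MeasurableSet[ℱ (t - 1)] A) :
    ∫⁻ ω in A, ENNReal.ofReal (ε t ω ^ 2) ∂μ = ENNReal.ofReal (σ ^ 2) * μ A := by
  have hi : Integrable (fun ω => ε t ω ^ 2) μ := (hε.memLp t).integrable_sq
  rw [← ofReal_integral_eq_lintegral_ofReal hi.integrableOn (ae_of_all _ fun ω => sq_nonneg _),
    ← setIntegral_condExp (ℱ.le (t - 1)) hi hA,
    setIntegral_congr_ae (g := fun _ => σ ^ 2) (ℱ.le _ A hA)
      ((hε.condVar t).mono fun ω h _ => h), setIntegral_const, smul_eq_mul, mul_comm,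
    ENNReal.ofReal_mul (sq_nonneg _), ofReal_measureReal]

/-- Products of the noise with square-integrable variables of the past are square-integrable. -/
theorem lintegral_mul_sq (hε : IsMartingaleNoise μ ℱ σ α ε) {t : ℤ} {f : Ω → ℝ}
    (hf : AEStronglyMeasurable[ℱ (t - 1)] f μ) :
    ∫⁻ ω, ENNReal.ofReal ((f ω * ε t ω) ^ 2) ∂μ
      = ENNReal.ofReal (σ ^ 2) * ∫⁻ ω, ENNReal.ofReal (f ω ^ 2) ∂μ := by
  obtain ⟨f', hf', hae⟩ := hf
  have h := lintegral_mul_of_setLIntegral (μ := μ) (ℱ.le (t - 1))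
    (f := fun ω => ENNReal.ofReal (f' ω ^ 2)) (g := fun ω => ENNReal.ofReal (ε t ω ^ 2))
    (hf'.measurable.pow_const 2).ennreal_ofReal ((hε.measurable t).pow_const 2).ennreal_ofReal
    fun A hA => hε.setLIntegral_sq t hA
  have h1 : ∫⁻ ω, ENNReal.ofReal (f ω ^ 2) ∂μ = ∫⁻ ω, ENNReal.ofReal (f' ω ^ 2) ∂μ :=
    lintegral_congr_ae (hae.mono fun ω h => by simp only [h])
  rw [h1, ← h]
  refine lintegral_congr_ae (hae.mono fun ω h => ?_)
  simp only [h]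
  rw [mul_pow, ENNReal.ofReal_mul (sq_nonneg _)]

/-- The constant conditional variance replaces fourth moments: `f ε_t` lies in `L²` as soon as `f`
does, which makes the strong law available with exponent 2. -/
theorem integrable_mul_sq (hε : IsMartingaleNoise μ ℱ σ α ε) {t : ℤ} {f : Ω → ℝ}
    (hf : AEStronglyMeasurable[ℱ (t - 1)] f μ) (hf2 : MemLp f 2 μ) :
    Integrable (fun ω => (f ω * ε t ω) ^ 2) μ ∧
      ∫ ω, (f ω * ε t ω) ^ 2 ∂μ = σ ^ 2 * ∫ ω, f ω ^ 2 ∂μ := by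
  have hm : AEStronglyMeasurable (fun ω => (f ω * ε t ω) ^ 2) μ :=
    ((hf.mono (ℱ.le _)).mul (hε.memLp t).1).pow 2
  have h := hε.lintegral_mul_sq hf
  have hf' : ∫⁻ ω, ENNReal.ofReal (f ω ^ 2) ∂μ ≠ ⊤ := by
    rw [← ofReal_integral_eq_lintegral_ofReal hf2.integrable_sq (ae_of_all _ fun ω => sq_nonneg _)]
    exact ENNReal.ofReal_ne_top
  constructor
  · refine ⟨hm, ?_⟩
    rw [hasFiniteIntegral_iff_ofReal (ae_of_all _ fun ω => sq_nonneg _), h]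
    exact ENNReal.mul_lt_top ENNReal.ofReal_lt_top hf'.lt_top
  · rw [integral_eq_lintegral_of_nonneg_ae (ae_of_all _ fun ω => sq_nonneg _) hm, h,
      ENNReal.toReal_mul, ENNReal.toReal_ofReal (sq_nonneg _),
      integral_eq_lintegral_of_nonneg_ae (ae_of_all _ fun ω => sq_nonneg _)
        hf2.integrable_sq.1]

end IsMartingaleNoise

/-- The restriction of a filtration indexed by `ℤ` to `ℕ`. -/
def natFiltration (ℱ : Filtration ℤ mΩ) : Filtration ℕ mΩ where
  seq n := ℱ n
  mono' _ _ h := ℱ.mono (by exact_mod_cast h)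
  le' n := ℱ.le n

namespace IsMartingaleNoise

variable {ℱ : Filtration ℤ mΩ} {σ α : ℝ} {ε : ℤ → Ω → ℝ}

/-- The law of large numbers for the noise times an adapted `L²`-bounded sequence. -/
theorem ae_hasMean_mul (hε : IsMartingaleNoise μ ℱ σ α ε) {f : ℕ → Ω → ℝ} {B : ℝ}
    (hf : ∀ i : ℕ, AEStronglyMeasurable[ℱ i] (f i) μ) (hf2 : ∀ i, MemLp (f i) 2 μ)
    (hB : ∀ i, ∫ ω, f i ω ^ 2 ∂μ ≤ B) :
    ∀ᵐ ω ∂μ, HasMean (fun i : ℕ => f i ω * ε ((i : ℤ) + 1) ω) 0 := by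
  have hsh : ∀ i : ℕ, ((i : ℤ) + 1 - 1) = i := fun i => by ring
  have hf' : ∀ i : ℕ, AEStronglyMeasurable[ℱ ((i : ℤ) + 1 - 1)] (f i) μ := fun i => by
    rw [hsh]; exact hf i
  have e2 : ∀ i : ℕ, (fun ω => |(f i * ε ((i : ℤ) + 1)) ω| ^ (2 : ℝ))
      = fun ω => (f i ω * ε ((i : ℤ) + 1) ω) ^ 2 := fun i => by
    ext ω
    rw [Real.rpow_two, sq_abs, Pi.mul_apply]
  refine ae_hasMean_zero (μ := μ) (𝒢 := natFiltration ℱ)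
    (D := fun i => f i * ε ((i : ℤ) + 1)) (p := 2) (C := σ ^ 2 * B) (fun i => ?_)
    (fun i => (hf2 i).integrable_mul (hε.memLp _)) (fun i => ?_) one_lt_two le_rfl
    (fun i => ?_) (fun i => ?_)
  · have h1 : AEStronglyMeasurable[ℱ ((i : ℤ) + 1)] (f i) μ :=
      (hf i).mono (ℱ.mono (by omega))
    have h2 : AEStronglyMeasurable[ℱ ((i : ℤ) + 1)] (ε ((i : ℤ) + 1)) μ :=
      (hε.adapted _).stronglyMeasurable.aestronglyMeasurable
    have h3 : (natFiltration ℱ) (i + 1) = ℱ ((i : ℤ) + 1) := by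
      change ℱ ((i + 1 : ℕ) : ℤ) = _
      rw [Nat.cast_succ]
    rw [h3]
    exact h1.mul h2
  · have := hε.condExp_mul_eq_zero (hf' i) (hf2 i)
    rw [hsh] at this
    exact this
  · rw [e2]
    exact (hε.integrable_mul_sq (hf' i) (hf2 i)).1
  · rw [e2, (hε.integrable_mul_sq (hf' i) (hf2 i)).2]
    exact mul_le_mul_of_nonneg_left (hB i) (sq_nonneg _)

/-- The conditional `α`-th moment of the noise. -/
noncomputable def condMomentAt (μ : Measure Ω) (ℱ : Filtration ℤ mΩ) (α : ℝ) (ε : ℤ → Ω → ℝ)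
    (t : ℤ) : Ω → ENNReal :=
  condLExp (ℱ (t - 1)) μ (fun ω' => ENNReal.ofReal (|ε t ω'| ^ α))

/-- Truncating where the conditional moment is large leaves bounded moments. -/
theorem integral_indicator_rpow_le (hε : IsMartingaleNoise μ ℱ σ α ε) (t : ℤ) (N : ℕ) :
    Integrable ({ω | condMomentAt μ ℱ α ε t ω ≤ N}.indicator fun ω => |ε t ω| ^ α) μ ∧
    ∫ ω, {ω | condMomentAt μ ℱ α ε t ω ≤ N}.indicator (fun ω => |ε t ω| ^ α) ω ∂μ ≤ N := by
  have hm : Measurable (fun ω => |ε t ω| ^ α) :=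
    ((continuous_abs.measurable.comp (hε.measurable t))).pow_const α
  -- The event belongs to the past, so on it the moment may be replaced by its conditional version,
  -- which is at most `N` there.
  have hS : MeasurableSet[ℱ (t - 1)] {ω | condMomentAt μ ℱ α ε t ω ≤ N} :=
    measurableSet_le (measurable_condLExp _ _ _) measurable_const
  set S := {ω | condMomentAt μ ℱ α ε t ω ≤ N} with hSdef
  have hS' : MeasurableSet S := ℱ.le _ _ hS
  have hle : ∫⁻ ω, ENNReal.ofReal (S.indicator (fun ω => |ε t ω| ^ α) ω) ∂μ ≤ N := by
    have e : ∀ ω, ENNReal.ofReal (S.indicator (fun ω => |ε t ω| ^ α) ω)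
        = S.indicator (fun ω => ENNReal.ofReal (|ε t ω| ^ α)) ω := fun ω => by
      by_cases h : ω ∈ S <;> simp [h]
    simp_rw [e]
    rw [lintegral_indicator hS', ← setLIntegral_condLExp (ℱ.le (t - 1)) μ _ hS]
    calc ∫⁻ ω in S, condMomentAt μ ℱ α ε t ω ∂μ ≤ ∫⁻ _ in S, (N : ENNReal) ∂μ :=
          setLIntegral_mono measurable_const fun ω hω => hω
      _ = N * μ S := by rw [setLIntegral_const]
      _ ≤ N * 1 := by gcongr; exact prob_le_one
      _ = N := mul_one _
  have hnn : ∀ ω, 0 ≤ S.indicator (fun ω => |ε t ω| ^ α) ω := fun ω =>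
    Set.indicator_nonneg (fun _ _ => by positivity) ω
  have hmeas : AEStronglyMeasurable (S.indicator fun ω => |ε t ω| ^ α) μ :=
    (hm.indicator hS').aestronglyMeasurable
  constructor
  · refine ⟨hmeas, ?_⟩
    rw [hasFiniteIntegral_iff_ofReal (ae_of_all _ hnn)]
    exact lt_of_le_of_lt hle (ENNReal.natCast_lt_top N)
  · rw [integral_eq_lintegral_of_nonneg_ae (ae_of_all _ hnn) hmeas]
    exact ENNReal.toReal_le_of_le_ofReal (Nat.cast_nonneg N) (by simpa using hle)

/-- Converts control of the `α`-th moment of the noise into control of the `p`-th moment of `ε² -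
σ²`, as the strong law requires. -/
theorem abs_sq_sub_rpow_le {e s p α : ℝ} (hp : 1 < p) (hpα : 2 * p ≤ α) :
    |e ^ 2 - s ^ 2| ^ p ≤ 2 ^ p * (1 + |e| ^ α + |s| ^ (2 * p)) := by
  have h1 : |e ^ 2 - s ^ 2| ≤ 2 * max (e ^ 2) (s ^ 2) := by
    rw [abs_le]
    constructor <;> nlinarith [le_max_left (e ^ 2) (s ^ 2), le_max_right (e ^ 2) (s ^ 2),
      sq_nonneg e, sq_nonneg s]
  have hpow : ∀ y : ℝ, (y ^ 2) ^ p = |y| ^ (2 * p) := fun y => by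
    rw [← sq_abs, Real.rpow_mul (abs_nonneg _), Real.rpow_two]
  have h2 : |e| ^ (2 * p) ≤ 1 + |e| ^ α := by
    rcases le_total |e| 1 with h | h
    · have h3 := Real.rpow_le_one (abs_nonneg e) h (by linarith : 0 ≤ 2 * p)
      have h4 : 0 ≤ |e| ^ α := by positivity
      linarith
    · have := Real.rpow_le_rpow_of_exponent_le h hpα
      linarith
  calc |e ^ 2 - s ^ 2| ^ p ≤ (2 * max (e ^ 2) (s ^ 2)) ^ p :=
        Real.rpow_le_rpow (abs_nonneg _) h1 (by linarith)
    _ = 2 ^ p * (max (e ^ 2) (s ^ 2)) ^ p :=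
        Real.mul_rpow (by norm_num) (le_max_of_le_left (sq_nonneg _))
    _ ≤ 2 ^ p * (1 + |e| ^ α + |s| ^ (2 * p)) := by
        refine mul_le_mul_of_nonneg_left ?_ (by positivity)
        have h5 : 0 ≤ |e| ^ α := by positivity
        have h6 : 0 ≤ |s| ^ (2 * p) := by positivity
        rcases max_cases (e ^ 2) (s ^ 2) with ⟨h, _⟩ | ⟨h, _⟩
        · rw [h, hpow]; linarith
        · rw [h, hpow]; linarith

/-- The averages of the squared noise converge to `σ ^ 2`. -/
theorem ae_hasMean_sq (hε : IsMartingaleNoise μ ℱ σ α ε) (hα : 2 < α) :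
    ∀ᵐ ω ∂μ, HasMean (fun i : ℕ => ε ((i : ℤ) + 1) ω ^ 2) (σ ^ 2) := by
  -- `α > 2` makes `p > 1`, while `2 p ≤ α` lets the conditional moment control `|ε² - σ²| ^ p`.
  set p : ℝ := min (α / 2) 2 with hp_def
  have hp1 : 1 < p := lt_min (by linarith) (by norm_num)
  have hp2 : p ≤ 2 := min_le_right _ _
  have hpα : 2 * p ≤ α := by have := min_le_left (α / 2) 2; linarith
  have hsh : ∀ i : ℕ, ((i : ℤ) + 1 - 1) = i := fun i => by ring
  set S : ℕ → ℕ → Set Ω := fun N i => {ω | condMomentAt μ ℱ α ε ((i : ℤ) + 1) ω ≤ N} with hS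
  have hSm : ∀ N i : ℕ, MeasurableSet[ℱ i] (S N i) := fun N i => by
    have : MeasurableSet[ℱ ((i : ℤ) + 1 - 1)] (S N i) :=
      measurableSet_le (measurable_condLExp _ _ _) measurable_const
    rwa [hsh] at this
  have hSm' : ∀ N i, MeasurableSet (S N i) := fun N i => ℱ.le _ _ (hSm N i)
  set f : ℕ → Ω → ℝ := fun i ω => ε ((i : ℤ) + 1) ω ^ 2 - σ ^ 2 with hf
  have hfm : ∀ i : ℕ, Measurable[ℱ ((i : ℤ) + 1)] (f i) := fun i =>
    ((hε.adapted _).pow_const 2).sub_const _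
  have hfint : ∀ i, Integrable (f i) μ := fun i =>
    (hε.memLp _).integrable_sq.sub (integrable_const _)
  have hfcond : ∀ i : ℕ, μ[f i | ℱ i] =ᵐ[μ] 0 := fun i => by
    have h1 := hε.condVar ((i : ℤ) + 1)
    rw [hsh] at h1
    have h2 : μ[(fun ω => ε ((i : ℤ) + 1) ω ^ 2) - (fun _ => σ ^ 2) | ℱ i] =ᵐ[μ] _ :=
      condExp_sub (hε.memLp _).integrable_sq (integrable_const _) _
    refine EventuallyEq.trans h2 ?_
    rw [condExp_const (ℱ.le i)]
    filter_upwards [h1] with ω h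
    simp [h]
  -- Multiplying by the indicator of a past event keeps the martingale difference property and
  -- bounds the `p`-th moments uniformly in `i`.
  have hmain : ∀ N : ℕ, ∀ᵐ ω ∂μ, HasMean (fun i => (S N i).indicator (f i) ω) 0 := by
    intro N
    set Ci : ℝ := 2 ^ p * (1 + N + |σ| ^ (2 * p)) with hCi
    have hWi := fun i : ℕ => hε.integral_indicator_rpow_le ((i : ℤ) + 1) N
    set W : ℕ → Ω → ℝ := fun i => (S N i).indicator (fun ω => |ε ((i : ℤ) + 1) ω| ^ α) with hW
    have hWint : ∀ i, Integrable (W i) μ := fun i => (hWi i).1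
    have hbint : ∀ i, Integrable (fun ω => 2 ^ p * (1 + W i ω + |σ| ^ (2 * p))) μ := fun i =>
      ((((integrable_const 1).add (hWint i)).add (integrable_const _)).const_mul _)
    have hle : ∀ i ω, |(S N i).indicator (f i) ω| ^ p
        ≤ 2 ^ p * (1 + W i ω + |σ| ^ (2 * p)) := fun i ω => by
      by_cases h : ω ∈ S N i
      · simp only [hW, Set.indicator_of_mem h]
        exact abs_sq_sub_rpow_le hp1 hpα
      · simp only [hW, Set.indicator_of_notMem h, abs_zero]
        rw [Real.zero_rpow (by linarith)]
        positivity
    have hDm : ∀ i : ℕ, Measurable[ℱ ((i : ℤ) + 1)] ((S N i).indicator (f i)) := fun i =>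
      (hfm i).indicator (ℱ.mono (by omega) _ (hSm N i))
    refine ae_hasMean_zero (μ := μ) (𝒢 := natFiltration ℱ)
      (D := fun i => (S N i).indicator (f i)) (p := p) (C := Ci) (fun i => ?_)
      (fun i => (hfint i).indicator (hSm' N i)) (fun i => ?_) hp1 hp2 (fun i => ?_) (fun i => ?_)
    · have h3 : (natFiltration ℱ) (i + 1) = ℱ ((i : ℤ) + 1) := by
        change ℱ ((i + 1 : ℕ) : ℤ) = _
        rw [Nat.cast_succ]
      rw [h3]
      exact (hDm i).stronglyMeasurable.aestronglyMeasurable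
    · refine EventuallyEq.trans (condExp_indicator (hfint i) (hSm N i)) ?_
      filter_upwards [hfcond i] with ω h
      by_cases h' : ω ∈ S N i
      · rw [Set.indicator_of_mem h']; exact h
      · rw [Set.indicator_of_notMem h']; rfl
    · refine (hbint i).mono' ?_ (ae_of_all _ fun ω => ?_)
      · have hm : Measurable ((S N i).indicator (f i)) := (hDm i).mono (ℱ.le _) le_rfl
        exact ((continuous_abs.measurable.comp hm).pow_const p).aestronglyMeasurable
      · rw [Real.norm_of_nonneg (by positivity)]
        exact hle i ω
    · refine (integral_mono_of_nonneg (ae_of_all _ fun ω => by positivity) (hbint i)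
        (ae_of_all _ fun ω => hle i ω)).trans ?_
      have i1 : Integrable (fun ω => 1 + W i ω) μ := (integrable_const 1).add (hWint i)
      rw [integral_const_mul, integral_add i1 (integrable_const _),
        integral_add (integrable_const 1) (hWint i)]
      have := (hWi i).2
      simp only [integral_const, probReal_univ, one_smul, hCi]
      gcongr
  -- Since the supremum of the conditional moments is finite at `ω`, some level `N` makes every
  -- indicator equal to 1 along this path.
  filter_upwards [ae_all_iff.2 hmain, hε.condMoment] with ω h1 h2
  obtain ⟨N, hN⟩ := ENNReal.exists_nat_gt h2.ne
  have hmem : ∀ i, ω ∈ S N i := fun i =>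
    (le_iSup (fun t : ℤ => condMomentAt μ ℱ α ε t ω) ((i : ℤ) + 1)).trans hN.le
  have h3 := (h1 N).add (HasMean.const (σ ^ 2))
  rw [zero_add] at h3
  refine h3.congr fun i => ?_
  rw [Set.indicator_of_mem (hmem i), hf]
  ring

theorem ae_tendsto_sq_div (hε : IsMartingaleNoise μ ℱ σ α ε) (hα : 2 < α) :
    ∀ᵐ ω ∂μ, Tendsto (fun n : ℕ => ε n ω ^ 2 / (n : ℝ)) atTop (𝓝 0) := by
  filter_upwards [hε.ae_hasMean_sq hα] with ω hω
  rw [← tendsto_add_atTop_iff_nat 1]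
  refine squeeze_zero' (Eventually.of_forall fun n => by positivity) ?_ hω.tendsto_div_zero
  filter_upwards [eventually_gt_atTop 0] with n hn
  rw [Nat.cast_succ]
  gcongr
  linarith

end IsMartingaleNoise

end Noise

/-! ### Zero padding -/

/-- Stated for a general summand so that it serves the characteristic polynomial, the recursion and
the dot products alike. -/
theorem sum_zeroExtend {M : Type*} [AddCommMonoid M] {k q : ℕ} (hkq : k ≤ q) (v : Fin k → ℝ)
    (F : ℝ → ℕ → M) (hF : ∀ n, F 0 n = 0) :
    ∑ i : Fin q, F (zeroExtend q v i) i = ∑ i : Fin k, F (v i) i := by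
  set g : ℕ → M := fun n => if h : n < k then F (v ⟨n, h⟩) n else 0 with hg
  have h1 : ∀ i : Fin q, F (zeroExtend q v i) i = g i := fun i => by
    by_cases h : (i : ℕ) < k <;> simp [hg, zeroExtend, h, hF]
  have h2 : ∀ i : Fin k, F (v i) i = g i := fun i => by simp [hg]
  rw [Finset.sum_congr rfl fun i _ => h1 i, Finset.sum_congr rfl fun i _ => h2 i,
    Fin.sum_univ_eq_sum_range, Fin.sum_univ_eq_sum_range]
  refine (Finset.sum_subset (Finset.range_subset_range.2 hkq) fun n _ hn => ?_).symm
  have : ¬ n < k := by simpa using hn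
  simp [hg, this]

theorem lagVec_dotProduct_zeroExtend {k q : ℕ} (hkq : k ≤ q) (u : ℤ → ℝ) (v : Fin k → ℝ) (t : ℤ) :
    lagVec u q t ⬝ᵥ zeroExtend q v = lagVec u k t ⬝ᵥ v :=
  sum_zeroExtend hkq v (fun c n => u (t - (n : ℤ)) * c) fun _ => mul_zero _

theorem tendsto_matrix_iff {ι m n : Type*} {l : Filter ι} {f : ι → Matrix m n ℝ}
    {A : Matrix m n ℝ} :
    Tendsto f l (𝓝 A) ↔ ∀ i j, Tendsto (fun k => f k i j) l (𝓝 (A i j)) :=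
  (tendsto_pi_nhds (f := f) (g := A)).trans (forall_congr' fun _ => tendsto_pi_nhds)

/-! ### Averages of lagged products along a path -/

section Path

variable {q : ℕ} {a : Fin q → ℝ} {u e : ℤ → ℝ} {s : ℝ}

theorem tendsto_lag_sq_div (hu : Tendsto (fun n : ℕ => u n ^ 2 / (n : ℝ)) atTop (𝓝 0)) (i : ℕ) :
    Tendsto (fun n : ℕ => u ((n : ℤ) - i) ^ 2 / (n : ℝ)) atTop (𝓝 0) := by
  rw [← tendsto_add_atTop_iff_nat i]
  refine squeeze_zero' (Eventually.of_forall fun n => by positivity) ?_ hu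
  filter_upwards [eventually_gt_atTop 0] with n hn
  have h1 : (((n + i : ℕ) : ℤ) - (i : ℤ)) = n := by push_cast; ring
  rw [h1]
  gcongr
  omega

theorem tendsto_lag_mul_div (hu : Tendsto (fun n : ℕ => u n ^ 2 / (n : ℝ)) atTop (𝓝 0))
    (i j : ℕ) :
    Tendsto (fun n : ℕ => u ((n : ℤ) - i) * u ((n : ℤ) - j) / (n : ℝ)) atTop (𝓝 0) := by
  have h := (tendsto_lag_sq_div hu i).add (tendsto_lag_sq_div hu j)
  rw [add_zero] at h
  refine squeeze_zero_norm (fun n => ?_) h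
  rw [Real.norm_eq_abs, abs_div, Nat.abs_cast, ← add_div]
  refine div_le_div_of_nonneg_right ?_ (Nat.cast_nonneg n)
  rw [abs_le]
  constructor <;> nlinarith [sq_nonneg (u ((n : ℤ) - i) + u ((n : ℤ) - j)),
    sq_nonneg (u ((n : ℤ) - i) - u ((n : ℤ) - j)), sq_nonneg (u ((n : ℤ) - i)),
    sq_nonneg (u ((n : ℤ) - j))]

/-- The averages of noise times present or past values. -/
theorem hasMean_noise_mul_lag
    (hu : ∀ t : ℤ, u (t + 1) = ∑ i : Fin q, a i * u (t - ((i : ℕ) : ℤ)) + e (t + 1))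
    (h1 : ∀ l : ℕ, HasMean (fun m : ℕ => u ((m : ℤ) - l) * e ((m : ℤ) + 1)) 0)
    (h2 : HasMean (fun m : ℕ => e ((m : ℤ) + 1) ^ 2) s) (i : ℕ) :
    HasMean (fun m : ℕ => u ((m : ℤ) + 1 - i) * e ((m : ℤ) + 1)) (if i = 0 then s else 0) := by
  rcases Nat.eq_zero_or_pos i with rfl | hi
  · have h := (HasMean.sum Finset.univ fun (k : Fin q) _ => (h1 k).const_mul (a k)).add h2
    simp only [mul_zero, Finset.sum_const_zero, zero_add] at h
    rw [if_pos rfl]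
    refine h.congr fun m => ?_
    rw [Nat.cast_zero, sub_zero, hu, add_mul, Finset.sum_mul, sq]
    congr 1
    exact Finset.sum_congr rfl fun k _ => by ring
  · rw [if_neg hi.ne']
    refine (h1 (i - 1)).congr fun m => ?_
    congr 2
    omega

/-- Averages of lagged products along a solution of a stable recursion converge to the solution
`Γ` of the discrete Lyapunov equation. -/
theorem hasMean_lag_mul_lag
    (ha : ∀ z : ℂ, ‖z‖ ≤ 1 → 1 - ∑ i : Fin q, (a i : ℂ) * z ^ ((i : ℕ) + 1) ≠ 0)
    (hu : ∀ t : ℤ, u (t + 1) = ∑ i : Fin q, a i * u (t - ((i : ℕ) : ℤ)) + e (t + 1))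
    (h1 : ∀ l : ℕ, HasMean (fun m : ℕ => u ((m : ℤ) - l) * e ((m : ℤ) + 1)) 0)
    (h2 : HasMean (fun m : ℕ => e ((m : ℤ) + 1) ^ 2) s)
    (h3 : Tendsto (fun n : ℕ => u n ^ 2 / (n : ℝ)) atTop (𝓝 0))
    {G : Matrix (Fin q) (Fin q) ℝ}
    (hG : ∀ i j : Fin q, G i j - (transition a * G * (transition a).transpose) i j
      = if (i : ℕ) = 0 ∧ (j : ℕ) = 0 then s else 0) (i j : Fin q) :
    HasMean (fun m : ℕ => u ((m : ℤ) - ((i : ℕ) : ℤ)) * u ((m : ℤ) - ((j : ℕ) : ℤ))) (G i j) := by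
  set Φ := transition a with hΦ
  -- the Lyapunov operator
  let L : Matrix (Fin q) (Fin q) ℝ →ₗ[ℝ] Matrix (Fin q) (Fin q) ℝ :=
    { toFun := fun A => A - Φ * A * Φ.transpose
      map_add' := fun A B => by
        rw [Matrix.mul_add, Matrix.add_mul]; abel
      map_smul' := fun c A => by
        simp [smul_sub] }
  have hLinj : Function.Injective L := by
    rw [← LinearMap.ker_eq_bot, LinearMap.ker_eq_bot']
    intro A hA
    exact eq_zero_of_transition_conj ha (sub_eq_zero.1 hA)
  let Le := LinearEquiv.ofInjectiveEndo L hLinj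
  -- In finite dimension the inverse of the Lyapunov operator is continuous, so convergence of `L (S
  -- n)` to `L G` suffices.
  have hcont : Continuous Le.symm := Le.symm.toLinearMap.continuous_of_finiteDimensional
  set S : ℕ → Matrix (Fin q) (Fin q) ℝ := fun n => Matrix.of fun i j =>
    (∑ m ∈ Finset.range n, lagVec u q m i * lagVec u q m j) / (n : ℝ) with hS
  -- Insert `Φ 𝐱_m = 𝐱_{m+1} - e_{m+1} e₀` and expand the product: a telescoping difference, two
  -- cross terms and the squared noise. At entry `(0, 0)` they add up to `0 + s + s - s`.
  have hLS : Tendsto (fun n => L (S n)) atTop (𝓝 (L G)) := by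
    refine tendsto_matrix_iff.2 fun i j => ?_
    have hLG : L G i j = if (i : ℕ) = 0 ∧ (j : ℕ) = 0 then s else 0 := hG i j
    rw [hLG]
    -- the four contributions
    have m1 : HasMean (fun m : ℕ => lagVec u q m i * lagVec u q m j
        - lagVec u q (m + 1) i * lagVec u q (m + 1) j) 0 := by
      have t1 := tendsto_lag_mul_div h3 i j
      have t0 : Tendsto (fun n : ℕ => lagVec u q 0 i * lagVec u q 0 j / (n : ℝ)) atTop (𝓝 0) :=
        tendsto_const_nhds.div_atTop tendsto_natCast_atTop_atTop
      have t2 := t0.sub t1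
      rw [sub_zero] at t2
      unfold HasMean
      refine t2.congr fun n => ?_
      rw [← sub_div]
      congr 1
      have := Finset.sum_range_sub' (fun m : ℕ => lagVec u q m i * lagVec u q m j) n
      simp only [Nat.cast_zero, Nat.cast_succ] at this
      rw [this]
      rfl
    set δ : Fin q → ℝ := fun i => if (i : ℕ) = 0 then 1 else 0 with hδ
    have m2 := (hasMean_noise_mul_lag hu h1 h2 i).const_mul (δ j)
    have m3 := (hasMean_noise_mul_lag hu h1 h2 j).const_mul (δ i)
    have m4 := h2.const_mul (δ i * δ j)
    have m5 := ((m1.add m2).add m3).sub m4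
    have hval : 0 + δ j * (if (i : ℕ) = 0 then s else 0) + δ i * (if (j : ℕ) = 0 then s else 0)
        - δ i * δ j * s = if (i : ℕ) = 0 ∧ (j : ℕ) = 0 then s else 0 := by
      by_cases hi : (i : ℕ) = 0 <;> by_cases hj : (j : ℕ) = 0 <;> simp [hδ, hi, hj]
    rw [hval] at m5
    unfold HasMean at m5
    refine m5.congr fun n => ?_
    have hstep : ∀ (m : ℕ) (i : Fin q), ∑ k, Φ i k * lagVec u q m k
        = lagVec u q (m + 1) i - δ i * e (m + 1) := fun m i => by
      have := transition_mulVec_lagVec hu m i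
      rw [Matrix.mulVec, dotProduct] at this
      rw [hΦ, this, hδ]
      by_cases hi : (i : ℕ) = 0 <;> simp [hi]
    have hconj : (Φ * S n * Φ.transpose) i j = (∑ m ∈ Finset.range n,
        (∑ k, Φ i k * lagVec u q m k) * (∑ k, Φ j k * lagVec u q m k)) / (n : ℝ) := by
      simp only [Matrix.mul_apply, Matrix.transpose_apply, hS, Matrix.of_apply]
      rw [Finset.sum_div]
      simp only [div_eq_mul_inv, Finset.sum_mul, Finset.mul_sum]
      conv_rhs => rw [Finset.sum_comm]
      refine Finset.sum_congr rfl fun k _ => ?_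
      conv_rhs => rw [Finset.sum_comm]
      refine Finset.sum_congr rfl fun l _ => ?_
      refine Finset.sum_congr rfl fun m _ => ?_
      ring
    have hL : L (S n) i j = S n i j - (Φ * S n * Φ.transpose) i j := rfl
    rw [hL, hconj]
    simp only [hstep, hS, Matrix.of_apply]
    rw [← sub_div, ← Finset.sum_sub_distrib]
    congr 1
    refine Finset.sum_congr rfl fun m _ => ?_
    simp only [lagVec]
    ring
  have hfin := (hcont.tendsto (L G)).comp hLS
  have e1 : ∀ A, Le.symm (L A) = A := fun A => Le.symm_apply_apply A
  rw [e1] at hfin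
  have h4 := tendsto_matrix_iff.1 hfin i j
  refine h4.congr fun n => ?_
  rw [Function.comp_apply, e1]
  rfl

end Path

/-! ### Stable autoregressive processes -/

/-- A weakly stationary solution of a stable autoregressive recursion of order at most `q`. -/
structure IsStableAR {Ω : Type*} [MeasurableSpace Ω] (μ : Measure Ω) (q : ℕ)
    (a : Fin q → ℝ) (x ε : ℤ → Ω → ℝ) : Prop where
  stationary : IsWeaklyStationary μ x
  pos : 0 < q
  no_zero : ∀ z : ℂ, ‖z‖ ≤ 1 → 1 - ∑ i : Fin q, (a i : ℂ) * z ^ ((i : ℕ) + 1) ≠ 0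
  ae_recursion : ∀ᵐ ω ∂μ, ∀ t : ℤ,
    x (t + 1) ω = ∑ i : Fin q, a i * x (t - ((i : ℕ) : ℤ)) ω + ε (t + 1) ω

/-- Dropping exactness of the order allows padding by zero coefficients, and the Lyapunov argument
at order `q` then yields all lags below `q`. -/
theorem IsStationaryAR.isStableAR {Ω : Type*} [MeasurableSpace Ω] {μ : Measure Ω} {p : ℕ}
    {a : Fin p → ℝ} {x ε : ℤ → Ω → ℝ} (hAR : IsStationaryAR μ p a x ε) {q : ℕ} (hpq : p ≤ q) :
    IsStableAR μ q (zeroExtend q a) x ε where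
  stationary := hAR.stationary
  pos := by
    obtain ⟨i, _⟩ := hAR.order_exact
    exact i.pos.trans_le hpq
  no_zero z hz := by
    rw [sum_zeroExtend hpq a (fun c n => (c : ℂ) * z ^ (n + 1)) fun n => by simp]
    exact hAR.no_zero z hz
  ae_recursion := by
    filter_upwards [ae_all_iff.2 hAR.recursion] with ω hω t
    rw [sum_zeroExtend hpq a (fun c n => c * x (t - (n : ℤ)) ω) fun n => by simp]
    exact hω t

namespace IsStableAR

variable {Ω : Type*} {mΩ : MeasurableSpace Ω} {μ : Measure Ω}
  {q : ℕ} {a : Fin q → ℝ} {x ε : ℤ → Ω → ℝ} {ℱ : Filtration ℤ mΩ} {σ α : ℝ}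

theorem integrable_mul (hx : IsStableAR μ q a x ε) (s t : ℤ) :
    Integrable (fun ω => x s ω * x t ω) μ :=
  (hx.stationary.memLp s).integrable_mul (hx.stationary.memLp t)

theorem integrable_mul_noise (hx : IsStableAR μ q a x ε) (hε : IsMartingaleNoise μ ℱ σ α ε)
    (s t : ℤ) : Integrable (fun ω => x s ω * ε t ω) μ :=
  (hx.stationary.memLp s).integrable_mul (hε.memLp t)

variable [IsProbabilityMeasure μ]

theorem integrable (hx : IsStableAR μ q a x ε) (t : ℤ) : Integrable (x t) μ :=
  (hx.stationary.memLp t).integrable one_le_two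

/-- Expectations in the recursion give `(1 - ∑ a_i) E x = 0`, and `z = 1` is not a zero of the
characteristic polynomial. Covariances are therefore product moments. -/
theorem integral_eq_zero (hx : IsStableAR μ q a x ε) (hε : IsMartingaleNoise μ ℱ σ α ε) (t : ℤ) :
    ∫ ω, x t ω ∂μ = 0 := by
  have h1 : ∫ ω, x (0 + 1) ω ∂μ
      = ∫ ω, (∑ i : Fin q, a i * x (0 - ((i : ℕ) : ℤ)) ω + ε (0 + 1) ω) ∂μ :=
    integral_congr_ae (hx.ae_recursion.mono fun ω h => h 0)
  rw [integral_add (integrable_finsetSum _ fun i _ => (hx.integrable _).const_mul _)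
    (hε.integrable _), hε.integral_eq_zero, add_zero,
    integral_finsetSum _ fun i _ => (hx.integrable _).const_mul _] at h1
  simp only [integral_const_mul] at h1
  rw [hx.stationary.mean_eq _ t, Finset.sum_congr rfl fun i _ => by
    rw [hx.stationary.mean_eq (0 - ((i : ℕ) : ℤ)) t], ← Finset.sum_mul] at h1
  have h2 := hx.no_zero 1 (by simp)
  simp only [one_pow, mul_one] at h2
  have h3 : (1 - ∑ i, a i) ≠ 0 := fun h => h2 (by exact_mod_cast congrArg (Complex.ofReal) h)
  have h4 : (1 - ∑ i, a i) * ∫ ω, x t ω ∂μ = 0 := by linarith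
  exact (mul_eq_zero.1 h4).resolve_left h3

theorem integral_mul_shift (hx : IsStableAR μ q a x ε) (hε : IsMartingaleNoise μ ℱ σ α ε)
    (s t l : ℤ) : ∫ ω, x (s + l) ω * x (t + l) ω ∂μ = ∫ ω, x s ω * x t ω ∂μ := by
  have hcov : ∀ s t, covariance (x s) (x t) μ = ∫ ω, x s ω * x t ω ∂μ := fun s t => by
    rw [covariance_eq_sub (hx.stationary.memLp s) (hx.stationary.memLp t),
      hx.integral_eq_zero hε, zero_mul, sub_zero]
    rfl
  have h := hx.stationary.cov_eq (t + l) t (s - t)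
  rw [hcov, hcov] at h
  have e1 : t + l + (s - t) = s + l := by ring
  have e2 : t + (s - t) = s := by ring
  rwa [e1, e2] at h

theorem integral_sq (hx : IsStableAR μ q a x ε) (hε : IsMartingaleNoise μ ℱ σ α ε)
    (t : ℤ) : ∫ ω, x t ω ^ 2 ∂μ = ∫ ω, x 0 ω ^ 2 ∂μ := by
  have := hx.integral_mul_shift hε 0 0 t
  simpa [sq] using this

/-- The process is adapted up to null sets. -/
theorem aestronglyMeasurable (hx : IsStableAR μ q a x ε) (hε : IsMartingaleNoise μ ℱ σ α ε)
    (t : ℤ) : AEStronglyMeasurable[ℱ t] (x t) μ := by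
  obtain ⟨C, r, κ, ψ, hC, hr0, hr1, hκ, hψ, hexp⟩ := exists_recursion_expansion hx.pos hx.no_zero
  set B : ℝ := 1 + ∫ ω, x 0 ω ^ 2 ∂μ with hB
  have hxB : ∀ s, ∫ ω, |x s ω| ∂μ ≤ B := fun s => by
    rw [hB, ← hx.integral_sq hε s]
    have hsq := (hx.stationary.memLp s).integrable_sq
    have h1 : ∫ ω, |x s ω| ∂μ ≤ ∫ ω, (1 + x s ω ^ 2) ∂μ :=
      integral_mono (hx.integrable s).abs ((integrable_const 1).add hsq) fun ω => by
        simp only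
        rw [abs_le]
        constructor <;> nlinarith [sq_nonneg (x s ω + 1), sq_nonneg (x s ω - 1)]
    rwa [integral_add (integrable_const 1) hsq, integral_const, probReal_univ, one_smul] at h1
  -- Iterating `n` steps back, `x_t = R + P` with `P` measurable for `ℱ t` and `R` geometrically
  -- small in `L¹`. Only `R` contributes to the distance from the conditional expectation, which
  -- must therefore vanish.
  have hbound : ∀ n : ℕ, ∫ ω, |x t ω - (μ[x t | ℱ t]) ω| ∂μ ≤ 2 * (q * C * B) * r ^ n := by
    intro n
    set R : Ω → ℝ := fun ω => ∑ i, κ n i * x (t - n - ((i : ℕ) : ℤ)) ω with hR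
    set P : Ω → ℝ := fun ω => ∑ j ∈ Finset.range n, ψ j * ε (t - j) ω with hP
    have hdec : x t =ᵐ[μ] R + P := by
      filter_upwards [hx.ae_recursion] with ω hω
      have := hexp (fun s => x s ω) (fun s => ε s ω) hω (t - n) n
      simpa [hR, hP] using this
    have hRint : Integrable R μ := integrable_finsetSum _ fun i _ => (hx.integrable _).const_mul _
    have hPint : Integrable P μ := integrable_finsetSum _ fun i _ => (hε.integrable _).const_mul _
    have hPm : StronglyMeasurable[ℱ t] P := by
      refine Finset.stronglyMeasurable_fun_sum _ fun j _ => ?_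
      exact (((hε.adapted (t - j)).mono (ℱ.mono (by omega)) le_rfl).const_mul _).stronglyMeasurable
    have hcond : μ[x t | ℱ t] =ᵐ[μ] μ[R | ℱ t] + P := by
      refine (condExp_congr_ae hdec).trans ((condExp_add hRint hPint _).trans ?_)
      rw [condExp_of_stronglyMeasurable (ℱ.le t) hPm hPint]
    have h1 : ∫ ω, |x t ω - (μ[x t | ℱ t]) ω| ∂μ = ∫ ω, |R ω - (μ[R | ℱ t]) ω| ∂μ := by
      refine integral_congr_ae ?_
      filter_upwards [hdec, hcond] with ω h1 h2
      rw [h1, h2, Pi.add_apply, Pi.add_apply, add_sub_add_right_eq_sub]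
    have h2 : ∫ ω, |R ω - (μ[R | ℱ t]) ω| ∂μ ≤ 2 * ∫ ω, |R ω| ∂μ := by
      have h3 : ∫ ω, |R ω - (μ[R | ℱ t]) ω| ∂μ ≤ ∫ ω, (|R ω| + |(μ[R | ℱ t]) ω|) ∂μ :=
        integral_mono (hRint.sub integrable_condExp).abs (hRint.abs.add integrable_condExp.abs)
          fun ω => abs_sub _ _
      rw [integral_add hRint.abs integrable_condExp.abs] at h3
      have h4 := integral_norm_condExp_le (μ := μ) (m := ℱ t) R
      simp only [Real.norm_eq_abs] at h4
      linarith
    have h5 : ∫ ω, |R ω| ∂μ ≤ q * C * B * r ^ n := by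
      have hi : ∀ i : Fin q, Integrable (fun ω => |κ n i| * |x (t - n - ((i : ℕ) : ℤ)) ω|) μ :=
        fun i => (hx.integrable _).abs.const_mul _
      calc ∫ ω, |R ω| ∂μ ≤ ∫ ω, ∑ i, |κ n i| * |x (t - n - ((i : ℕ) : ℤ)) ω| ∂μ := by
            refine integral_mono hRint.abs (integrable_finsetSum _ fun i _ => hi i) fun ω => ?_
            refine (Finset.abs_sum_le_sum_abs _ _).trans (le_of_eq ?_)
            exact Finset.sum_congr rfl fun i _ => abs_mul _ _
        _ = ∑ i, |κ n i| * ∫ ω, |x (t - n - ((i : ℕ) : ℤ)) ω| ∂μ := by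
            rw [integral_finsetSum _ fun i _ => hi i]
            exact Finset.sum_congr rfl fun i _ => integral_const_mul _ _
        _ ≤ ∑ _i : Fin q, (C * r ^ n) * B := by
            refine Finset.sum_le_sum fun i _ => ?_
            exact mul_le_mul (hκ n i) (hxB _) (integral_nonneg fun ω => abs_nonneg _)
              (by positivity)
        _ = q * C * B * r ^ n := by
            rw [Finset.sum_const, Finset.card_univ, Fintype.card_fin, nsmul_eq_mul]
            ring
    rw [h1]
    linarith
  have hlim : Tendsto (fun n : ℕ => 2 * (q * C * B) * r ^ n) atTop (𝓝 0) := by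
    have := (tendsto_pow_atTop_nhds_zero_of_lt_one hr0.le hr1).const_mul (2 * (q * C * B))
    rwa [mul_zero] at this
  have hzero : ∫ ω, |x t ω - (μ[x t | ℱ t]) ω| ∂μ = 0 :=
    le_antisymm (ge_of_tendsto' hlim hbound) (integral_nonneg fun ω => abs_nonneg _)
  have habs : Integrable (fun ω => |x t ω - (μ[x t | ℱ t]) ω|) μ :=
    ((hx.integrable t).sub integrable_condExp).abs
  rw [integral_eq_zero_iff_of_nonneg (fun ω => abs_nonneg _) habs] at hzero
  refine ⟨μ[x t | ℱ t], stronglyMeasurable_condExp, ?_⟩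
  filter_upwards [hzero] with ω h
  exact sub_eq_zero.1 (abs_eq_zero.1 h)

theorem integral_mul_noise_of_lt (hx : IsStableAR μ q a x ε) (hε : IsMartingaleNoise μ ℱ σ α ε)
    {s t : ℤ} (hst : s < t) : ∫ ω, x s ω * ε t ω ∂μ = 0 :=
  hε.integral_mul_eq_zero ((hx.aestronglyMeasurable hε s).mono (ℱ.mono (by omega)))
    (hx.stationary.memLp s)

/-- In the recursion for `x_t` all past values are orthogonal to `ε_t`, so only `E ε_t²` survives.
-/
theorem integral_mul_noise_self (hx : IsStableAR μ q a x ε) (hε : IsMartingaleNoise μ ℱ σ α ε)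
    (t : ℤ) : ∫ ω, x t ω * ε t ω ∂μ = σ ^ 2 := by
  have h1 : ∫ ω, x t ω * ε t ω ∂μ
      = ∫ ω, (∑ i : Fin q, a i * (x (t - 1 - ((i : ℕ) : ℤ)) ω * ε t ω) + ε t ω ^ 2) ∂μ := by
    refine integral_congr_ae (hx.ae_recursion.mono fun ω h => ?_)
    have h' := h (t - 1)
    rw [sub_add_cancel] at h'
    simp only
    rw [h', add_mul, Finset.sum_mul, sq]
    congr 1
    exact Finset.sum_congr rfl fun i _ => by ring
  have hi : ∀ i : Fin q, Integrable (fun ω => a i * (x (t - 1 - ((i : ℕ) : ℤ)) ω * ε t ω)) μ :=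
    fun i => (hx.integrable_mul_noise hε _ _).const_mul _
  rw [h1, integral_add (integrable_finsetSum _ fun i _ => hi i) (hε.memLp t).integrable_sq,
    hε.integral_sq, integral_finsetSum _ fun i _ => hi i, Finset.sum_eq_zero, zero_add]
  intro i _
  rw [integral_const_mul, hx.integral_mul_noise_of_lt hε (by omega), mul_zero]

theorem covMatrix_apply (hx : IsStableAR μ q a x ε) (hε : IsMartingaleNoise μ ℱ σ α ε)
    (t : ℤ) {k : ℕ} (i j : Fin k) : covMatrix μ x k i j
      = ∫ ω, x (t - ((i : ℕ) : ℤ)) ω * x (t - ((j : ℕ) : ℤ)) ω ∂μ := by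
  have h := hx.integral_mul_shift hε (1 - ((i : ℕ) : ℤ)) (1 - ((j : ℕ) : ℤ)) (t - 1)
  have e : ∀ n : ℤ, 1 - n + (t - 1) = t - n := fun n => by ring
  rw [e, e] at h
  rw [h]
  rfl

/-- The covariance matrix solves the discrete Lyapunov equation. -/
theorem covMatrix_lyapunov (hx : IsStableAR μ q a x ε) (hε : IsMartingaleNoise μ ℱ σ α ε)
    (i j : Fin q) :
    covMatrix μ x q i j - (transition a * covMatrix μ x q * (transition a).transpose) i j
      = if (i : ℕ) = 0 ∧ (j : ℕ) = 0 then σ ^ 2 else 0 := by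
  set Φ := transition a with hΦ
  set δ : Fin q → ℝ := fun i => if (i : ℕ) = 0 then 1 else 0 with hδ
  -- The same expansion as along a path, with expectations in place of averages; stationarity makes
  -- the difference of second moments at times 1 and 2 vanish.
  have hstep : ∀ᵐ ω ∂μ, ∀ i : Fin q, ∑ k, Φ i k * x (1 - ((k : ℕ) : ℤ)) ω
      = x (2 - ((i : ℕ) : ℤ)) ω - δ i * ε 2 ω := by
    filter_upwards [hx.ae_recursion] with ω hω i
    have := transition_mulVec_lagVec (u := fun s => x s ω) (e := fun s => ε s ω) hω 1 i
    rw [Matrix.mulVec, dotProduct] at this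
    simp only [lagVec] at this
    rw [hΦ, this, hδ]
    by_cases hi : (i : ℕ) = 0 <;> simp [hi]
  have hxn : ∀ i : Fin q, ∫ ω, x (2 - ((i : ℕ) : ℤ)) ω * ε 2 ω ∂μ = δ i * σ ^ 2 := fun i => by
    by_cases hi : (i : ℕ) = 0
    · simp only [hδ, hi, if_true, one_mul, Nat.cast_zero, sub_zero]
      exact hx.integral_mul_noise_self hε 2
    · simp only [hδ, hi, if_false, zero_mul]
      exact hx.integral_mul_noise_of_lt hε (by omega)
  have hconj : (Φ * covMatrix μ x q * Φ.transpose) i j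
      = ∫ ω, (∑ k, Φ i k * x (1 - ((k : ℕ) : ℤ)) ω) * (∑ k, Φ j k * x (1 - ((k : ℕ) : ℤ)) ω) ∂μ := by
    have e : ∀ ω, (∑ k, Φ i k * x (1 - ((k : ℕ) : ℤ)) ω) * (∑ k, Φ j k * x (1 - ((k : ℕ) : ℤ)) ω)
        = ∑ l, ∑ k, Φ i k * Φ j l * (x (1 - ((k : ℕ) : ℤ)) ω * x (1 - ((l : ℕ) : ℤ)) ω) := fun ω => by
      rw [Finset.sum_mul_sum, Finset.sum_comm]
      exact Finset.sum_congr rfl fun l _ => Finset.sum_congr rfl fun k _ => by ring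
    simp_rw [e]
    have hi : ∀ l k : Fin q, Integrable (fun ω => Φ i k * Φ j l *
        (x (1 - ((k : ℕ) : ℤ)) ω * x (1 - ((l : ℕ) : ℤ)) ω)) μ :=
      fun l k => (hx.integrable_mul _ _).const_mul _
    rw [integral_finsetSum _ fun l _ => integrable_finsetSum _ fun k _ => hi l k]
    simp only [Matrix.mul_apply, Matrix.transpose_apply]
    refine Finset.sum_congr rfl fun l _ => ?_
    rw [integral_finsetSum _ fun k _ => hi l k, Finset.sum_mul]
    refine Finset.sum_congr rfl fun k _ => ?_
    rw [integral_const_mul, hx.covMatrix_apply hε 1]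
    ring
  rw [hconj, hx.covMatrix_apply hε 2 i j]
  have h1 : ∫ ω, (∑ k, Φ i k * x (1 - ((k : ℕ) : ℤ)) ω) * (∑ k, Φ j k * x (1 - ((k : ℕ) : ℤ)) ω) ∂μ
      = ∫ ω, (x (2 - ((i : ℕ) : ℤ)) ω * x (2 - ((j : ℕ) : ℤ)) ω
        + (-δ j) * (x (2 - ((i : ℕ) : ℤ)) ω * ε 2 ω)
        + (-δ i) * (x (2 - ((j : ℕ) : ℤ)) ω * ε 2 ω)
        + (δ i * δ j) * ε 2 ω ^ 2) ∂μ := by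
    refine integral_congr_ae (hstep.mono fun ω h => ?_)
    simp only
    rw [h i, h j]
    ring
  have i1 := hx.integrable_mul (2 - ((i : ℕ) : ℤ)) (2 - ((j : ℕ) : ℤ))
  have i2 := (hx.integrable_mul_noise hε (2 - ((i : ℕ) : ℤ)) 2).const_mul (-δ j)
  have i3 := (hx.integrable_mul_noise hε (2 - ((j : ℕ) : ℤ)) 2).const_mul (-δ i)
  have i4 := (hε.memLp 2).integrable_sq.const_mul (δ i * δ j)
  have i12 : Integrable (fun ω => x (2 - ((i : ℕ) : ℤ)) ω * x (2 - ((j : ℕ) : ℤ)) ω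
        + (-δ j) * (x (2 - ((i : ℕ) : ℤ)) ω * ε 2 ω)) μ := i1.add i2
  have i123 : Integrable (fun ω => x (2 - ((i : ℕ) : ℤ)) ω * x (2 - ((j : ℕ) : ℤ)) ω
        + (-δ j) * (x (2 - ((i : ℕ) : ℤ)) ω * ε 2 ω)
        + (-δ i) * (x (2 - ((j : ℕ) : ℤ)) ω * ε 2 ω)) μ := i12.add i3
  rw [h1, integral_add i123 i4, integral_add i12 i3, integral_add i1 i2, integral_const_mul,
    integral_const_mul, integral_const_mul, hxn, hxn, hε.integral_sq]
  by_cases hi : (i : ℕ) = 0 <;> by_cases hj : (j : ℕ) = 0 <;> simp [hδ, hi, hj]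

/-- The law of large numbers for products of lags below the order. -/
theorem ae_hasMean_lag (hx : IsStableAR μ q a x ε) (hε : IsMartingaleNoise μ ℱ σ α ε)
    (hα : 2 < α) :
    ∀ᵐ ω ∂μ, ∀ i j : Fin q,
      HasMean (fun m : ℕ => x ((m : ℤ) - ((i : ℕ) : ℤ)) ω * x ((m : ℤ) - ((j : ℕ) : ℤ)) ω)
        (covMatrix μ x q i j) := by
  have h1 : ∀ᵐ ω ∂μ, ∀ l : ℕ,
      HasMean (fun m : ℕ => x ((m : ℤ) - l) ω * ε ((m : ℤ) + 1) ω) 0 := by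
    refine ae_all_iff.2 fun l => ?_
    exact hε.ae_hasMean_mul (f := fun m => x ((m : ℤ) - l)) (B := ∫ ω, x 0 ω ^ 2 ∂μ)
      (fun m => (hx.aestronglyMeasurable hε _).mono (ℱ.mono (by omega)))
      (fun m => hx.stationary.memLp _) (fun m => (hx.integral_sq hε _).le)
  filter_upwards [h1, hε.ae_hasMean_sq hα, hε.ae_tendsto_sq_div hα, hx.ae_recursion] with ω
    g1 g2 g3 g4 i j
  exact hasMean_lag_mul_lag (u := fun s => x s ω) (e := fun s => ε s ω) hx.no_zero g4 g1 g2
    (tendsto_sq_div_of_noise (u := fun s => x s ω) (e := fun s => ε s ω) hx.pos hx.no_zero g4 g3)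
    (hx.covMatrix_lyapunov hε) i j

theorem integral_lagVec_dotProduct_sq (hx : IsStableAR μ q a x ε) (hε : IsMartingaleNoise μ ℱ σ α ε)
    (t : ℤ) {k : ℕ} (v : Fin k → ℝ) :
    ∫ ω, (lagVec (fun s => x s ω) k t ⬝ᵥ v) ^ 2 ∂μ = quadForm (covMatrix μ x k) v := by
  have e : ∀ ω, (lagVec (fun s => x s ω) k t ⬝ᵥ v) ^ 2
      = ∑ i, ∑ j, v i * v j * (x (t - ((i : ℕ) : ℤ)) ω * x (t - ((j : ℕ) : ℤ)) ω) := fun ω => by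
    rw [sq, dotProduct, Finset.sum_mul_sum]
    exact Finset.sum_congr rfl fun i _ => Finset.sum_congr rfl fun j _ => by
      simp only [lagVec]; ring
  have hi : ∀ i j : Fin k, Integrable (fun ω => v i * v j *
      (x (t - ((i : ℕ) : ℤ)) ω * x (t - ((j : ℕ) : ℤ)) ω)) μ :=
    fun i j => (hx.integrable_mul _ _).const_mul _
  simp_rw [e]
  rw [integral_finsetSum _ fun i _ => integrable_finsetSum _ fun j _ => hi i j, quadForm,
    dotProduct]
  refine Finset.sum_congr rfl fun i _ => ?_
  rw [integral_finsetSum _ fun j _ => hi i j, Matrix.mulVec, dotProduct, Finset.mul_sum]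
  refine Finset.sum_congr rfl fun j _ => ?_
  rw [integral_const_mul, hx.covMatrix_apply hε t]
  ring

/-- The lags of a stable autoregressive process are linearly independent. -/
theorem eq_zero_of_ae_dotProduct_eq_zero (hx : IsStableAR μ q a x ε)
    (hε : IsMartingaleNoise μ ℱ σ α ε) (hσ : 0 < σ) (t : ℤ) {k : ℕ} {v : Fin k → ℝ}
    (h : ∀ᵐ ω ∂μ, lagVec (fun s => x s ω) k t ⬝ᵥ v = 0) : v = 0 := by
  by_contra hv
  obtain ⟨i₁, hi₁⟩ := Function.ne_iff.1 hv
  -- `x_{t-i}` is the most recent value that occurs. Testing against `ε_{t-i}` annihilates all older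
  -- values and leaves `v i * σ ^ 2 = 0`.
  obtain ⟨i, hi, hmin⟩ := WellFounded.has_min (wellFounded_lt (α := Fin k)) {i | v i ≠ 0} ⟨i₁, hi₁⟩
  have h0 : ∫ ω, (lagVec (fun s => x s ω) k t ⬝ᵥ v) * ε (t - ((i : ℕ) : ℤ)) ω ∂μ = 0 := by
    rw [integral_congr_ae (g := fun _ => (0 : ℝ)) (h.mono fun ω hω => by simp only [hω, zero_mul]),
      integral_zero]
  have e : ∀ ω, (lagVec (fun s => x s ω) k t ⬝ᵥ v) * ε (t - ((i : ℕ) : ℤ)) ω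
      = ∑ j, v j * (x (t - ((j : ℕ) : ℤ)) ω * ε (t - ((i : ℕ) : ℤ)) ω) := fun ω => by
    rw [dotProduct, Finset.sum_mul]
    exact Finset.sum_congr rfl fun j _ => by simp only [lagVec]; ring
  simp_rw [e] at h0
  rw [integral_finsetSum _ fun j _ => (hx.integrable_mul_noise hε _ _).const_mul _,
    Finset.sum_eq_single i] at h0
  · rw [integral_const_mul, hx.integral_mul_noise_self hε] at h0
    exact hi ((mul_eq_zero.1 h0).resolve_right (by positivity))
  · intro j _ hj
    rw [integral_const_mul]
    rcases lt_or_gt_of_ne hj with hlt | hgt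
    · have : v j = 0 := by
        by_contra hvj
        exact hmin j hvj hlt
      rw [this, zero_mul]
    · have : (i : ℕ) < (j : ℕ) := hgt
      rw [hx.integral_mul_noise_of_lt hε (by omega), mul_zero]
  · simp

theorem eq_zero_of_quadForm_eq_zero (hx : IsStableAR μ q a x ε)
    (hε : IsMartingaleNoise μ ℱ σ α ε) (hσ : 0 < σ) {k : ℕ} {v : Fin k → ℝ}
    (h : quadForm (covMatrix μ x k) v = 0) : v = 0 := by
  rw [← hx.integral_lagVec_dotProduct_sq hε 0, integral_eq_zero_iff_of_nonneg (fun ω => sq_nonneg _)] at h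
  · refine hx.eq_zero_of_ae_dotProduct_eq_zero hε hσ 0 (h.mono fun ω hω => ?_)
    exact pow_eq_zero_iff two_ne_zero |>.1 hω
  · have : MemLp (fun ω => lagVec (fun s => x s ω) k 0 ⬝ᵥ v) 2 μ :=
      memLp_finsetSum _ fun i _ => (hx.stationary.memLp _).mul_const _
    exact this.integrable_sq

theorem isUnit_det_covMatrix (hx : IsStableAR μ q a x ε)
    (hε : IsMartingaleNoise μ ℱ σ α ε) (hσ : 0 < σ) (k : ℕ) : IsUnit (covMatrix μ x k).det := by
  rw [isUnit_iff_ne_zero]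
  intro hdet
  obtain ⟨v, hv, hv0⟩ := Matrix.exists_mulVec_eq_zero_iff.2 hdet
  refine hv (hx.eq_zero_of_quadForm_eq_zero hε hσ ?_)
  rw [quadForm, hv0, dotProduct_zero]

end IsStableAR

/-- The **law of large numbers** for lagged products of a stationary autoregression. -/
theorem IsStationaryAR.ae_hasMean_mul {Ω : Type*} {mΩ : MeasurableSpace Ω} {μ : Measure Ω}
    [IsProbabilityMeasure μ] {p : ℕ} {a : Fin p → ℝ} {x ε : ℤ → Ω → ℝ} {ℱ : Filtration ℤ mΩ}
    {σ α : ℝ} (hAR : IsStationaryAR μ p a x ε) (hε : IsMartingaleNoise μ ℱ σ α ε) (hα : 2 < α) :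
    ∀ᵐ ω ∂μ, ∀ s t : ℤ, HasMean (fun n : ℕ => x ((n : ℤ) + s) ω * x ((n : ℤ) + t) ω)
      (∫ ω, x s ω * x t ω ∂μ) := by
  have h : ∀ᵐ ω ∂μ, ∀ d : ℕ, ∀ i j : Fin (p + d),
      HasMean (fun m : ℕ => x ((m : ℤ) - ((i : ℕ) : ℤ)) ω * x ((m : ℤ) - ((j : ℕ) : ℤ)) ω)
        (covMatrix μ x (p + d) i j) :=
    ae_all_iff.2 fun d => (hAR.isStableAR (Nat.le_add_right p d)).ae_hasMean_lag hε hα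
  filter_upwards [h] with ω hω s t
  -- Viewed from time `N`, both `s` and `t` are nonnegative lags `i`, `j`; an order `p + (i + j +
  -- 1)` exceeds both, and shifting by `N` leaves Cesàro limits unchanged.
  obtain ⟨N, hN⟩ : ∃ N : ℕ, s ≤ N ∧ t ≤ N := ⟨s.toNat + t.toNat, by omega⟩
  obtain ⟨i, hi⟩ : ∃ i : ℕ, (i : ℤ) = N - s := ⟨(N - s).toNat, by omega⟩
  obtain ⟨j, hj⟩ : ∃ j : ℕ, (j : ℤ) = N - t := ⟨(N - t).toNat, by omega⟩
  have h1 := (hω (i + j + 1) ⟨i, by omega⟩ ⟨j, by omega⟩).shift N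
  rw [(hAR.isStableAR (Nat.le_add_right p (i + j + 1))).covMatrix_apply hε N] at h1
  have e1 : (N : ℤ) - (i : ℤ) = s := by omega
  have e2 : (N : ℤ) - (j : ℤ) = t := by omega
  simp only [e1, e2] at h1
  refine h1.congr fun n => ?_
  have e3 : ((n + N : ℕ) : ℤ) - (i : ℤ) = n + s := by push_cast; omega
  have e4 : ((n + N : ℕ) : ℤ) - (j : ℤ) = n + t := by push_cast; omega
  simp only [e3, e4]

/-! ### The multistep representation -/

section Representation

variable {p : ℕ} {a : Fin p → ℝ}

/-- This is `φ⁻¹ = 1 + (1 - φ) φ⁻¹`, written so that comparing coefficients yields the recursion for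
the `b_j`. -/
theorem maCoeff_inv (a : Fin p → ℝ) :
    (1 - ∑ i : Fin p, PowerSeries.C (a i) * PowerSeries.X ^ ((i : ℕ) + 1) : PowerSeries ℝ)⁻¹
      = 1 + ∑ i : Fin p, PowerSeries.C (a i) * (PowerSeries.X ^ ((i : ℕ) + 1) *
        (1 - ∑ i : Fin p, PowerSeries.C (a i) * PowerSeries.X ^ ((i : ℕ) + 1) : PowerSeries ℝ)⁻¹) := by
  set φ : PowerSeries ℝ := 1 - ∑ i : Fin p, PowerSeries.C (a i) * PowerSeries.X ^ ((i : ℕ) + 1)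
    with hφ
  have h0 : PowerSeries.constantCoeff φ ≠ 0 := by
    simp [hφ, map_sum]
  have h1 : φ * φ⁻¹ = 1 := PowerSeries.mul_inv_cancel φ h0
  have h2 : ∑ i : Fin p, PowerSeries.C (a i) * (PowerSeries.X ^ ((i : ℕ) + 1) * φ⁻¹)
      = (1 - φ) * φ⁻¹ := by
    rw [hφ, sub_sub_cancel, Finset.sum_mul]
    exact Finset.sum_congr rfl fun i _ => (mul_assoc _ _ _).symm
  rw [h2, sub_mul, h1]
  ring

theorem maCoeff_zero (a : Fin p → ℝ) : maCoeff a 0 = 1 := by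
  unfold maCoeff
  rw [maCoeff_inv]
  simp [map_sum]

theorem maCoeff_succ (a : Fin p → ℝ) (j : ℕ) :
    maCoeff a (j + 1) = ∑ i : Fin p, a i * if (i : ℕ) ≤ j then maCoeff a (j - i) else 0 := by
  unfold maCoeff
  conv_lhs => rw [maCoeff_inv]
  rw [map_add, map_sum]
  simp only [PowerSeries.coeff_C_mul, PowerSeries.coeff_X_pow_mul', PowerSeries.coeff_one]
  simp

/-- The recursion for the `b_j` makes the innovations satisfy the autoregression in the horizon,
with value zero at horizons that are not positive. This is what lets the multistep representation be
proved by induction. -/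
theorem eta_succ (a : Fin p → ℝ) (e : ℤ → ℝ) (h : ℕ) (t : ℤ) :
    eta a e (h + 1) t
      = ∑ i : Fin p, a i * (if (i : ℕ) ≤ h then eta a e (h - i) t else 0) + e (t + h + 1) := by
  unfold eta
  rw [Finset.sum_range_succ', maCoeff_zero, one_mul]
  congr 1
  · have e1 : ∀ j ∈ Finset.range h, maCoeff a (j + 1) * e (t + ((h + 1 : ℕ) : ℤ) - ((j + 1 : ℕ) : ℤ))
        = ∑ i : Fin p, a i * ((if (i : ℕ) ≤ j then maCoeff a (j - i) else 0) * e (t + h - j)) := by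
      intro j _
      rw [maCoeff_succ, Finset.sum_mul]
      have : t + ((h + 1 : ℕ) : ℤ) - ((j + 1 : ℕ) : ℤ) = t + h - j := by push_cast; ring
      rw [this]
      exact Finset.sum_congr rfl fun i _ => by ring
    rw [Finset.sum_congr rfl e1, Finset.sum_comm]
    refine Finset.sum_congr rfl fun i _ => ?_
    rw [← Finset.mul_sum]
    congr 1
    by_cases hi : (i : ℕ) ≤ h
    · rw [if_pos hi]
      have e2 : ∀ j ∈ Finset.range h,
          (if (i : ℕ) ≤ j then maCoeff a (j - i) else 0) * e (t + h - j)
            = if (i : ℕ) ≤ j then maCoeff a (j - i) * e (t + h - j) else 0 := fun j _ => by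
        split_ifs <;> simp
      rw [Finset.sum_congr rfl e2, ← Finset.sum_filter]
      have e3 : (Finset.range h).filter (fun j => (i : ℕ) ≤ j) = Finset.Ico (i : ℕ) h := by
        ext j; simp only [Finset.mem_filter, Finset.mem_range, Finset.mem_Ico]; omega
      rw [e3, Finset.sum_Ico_eq_sum_range]
      refine Finset.sum_congr rfl fun j hj => ?_
      have hj' := Finset.mem_range.1 hj
      congr 2
      · omega
      · push_cast [Nat.cast_sub hi]; ring
    · rw [if_neg hi]
      refine Finset.sum_eq_zero fun j hj => ?_
      have hj' := Finset.mem_range.1 hj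
      rw [if_neg (by omega), zero_mul]
  · congr 1
    push_cast
    ring

/-- The `h`-step ahead value is a fixed linear combination of the last `p` values plus the
`h`-step innovation. -/
theorem exists_multistep_coef (hp : 0 < p) (a : Fin p → ℝ) (h : ℕ) :
    ∃ c : Fin p → ℝ, ∀ u e : ℤ → ℝ,
      (∀ t : ℤ, u (t + 1) = ∑ i : Fin p, a i * u (t - ((i : ℕ) : ℤ)) + e (t + 1)) →
      ∀ t : ℤ, u (t + h) = lagVec u p t ⬝ᵥ c + eta a e h t := by
  induction h using Nat.strong_induction_on with
  | _ h ih =>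
    rcases h with _ | h
    · refine ⟨Pi.single ⟨0, hp⟩ 1, fun u e _ t => ?_⟩
      simp [eta, lagVec]
    -- Each term on the right of the recursion for `u (t + h + 1)` is either a prediction at the
    -- shorter horizon `h - i`, or, if `i > h`, already one of the lags at time `t`, at position `i
    -- - h`.
    · have hd : ∀ i : Fin p, ∃ d : Fin p → ℝ, ∀ u e : ℤ → ℝ,
          (∀ t : ℤ, u (t + 1) = ∑ i : Fin p, a i * u (t - ((i : ℕ) : ℤ)) + e (t + 1)) →
          ∀ t : ℤ, u (t + h - ((i : ℕ) : ℤ))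
            = lagVec u p t ⬝ᵥ d + if (i : ℕ) ≤ h then eta a e (h - i) t else 0 := by
        intro i
        by_cases hi : (i : ℕ) ≤ h
        · obtain ⟨d, hd⟩ := ih (h - i) (by omega)
          refine ⟨d, fun u e hu t => ?_⟩
          rw [if_pos hi, ← hd u e hu t]
          congr 1
          push_cast [Nat.cast_sub hi]
          ring
        · refine ⟨Pi.single ⟨i - h, by omega⟩ 1, fun u e _ t => ?_⟩
          rw [if_neg hi, add_zero, dotProduct_single, mul_one]
          simp only [lagVec]
          congr 1
          omega
      choose d hd using hd
      refine ⟨∑ i, a i • d i, fun u e hu t => ?_⟩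
      rw [eta_succ]
      have e1 : t + ((h + 1 : ℕ) : ℤ) = t + h + 1 := by push_cast; ring
      rw [e1, hu (t + h), dotProduct_sum, ← add_assoc, ← Finset.sum_add_distrib]
      congr 1
      refine Finset.sum_congr rfl fun i _ => ?_
      rw [hd i u e hu t, dotProduct_smul, smul_eq_mul, mul_add]

end Representation

/-! ### Least squares along a path -/

section Path

variable {u : ℤ → ℝ} {h k : ℕ}

theorem abs_mul_le_sq_add_sq (y z : ℝ) : |y * z| ≤ y ^ 2 + z ^ 2 := by
  rw [abs_le]
  constructor <;> nlinarith [sq_nonneg (y + z), sq_nonneg (y - z), sq_nonneg y, sq_nonneg z]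

/-- Replacing the coefficients of a linear predictor by convergent estimates does not change the
mean-squared prediction error. -/
theorem HasMean.sq_sub_of_tendsto {θ : Fin k → ℝ} {θn : ℕ → Fin k → ℝ} {L : ℝ} {M : Fin k → ℝ}
    (hθ : Tendsto θn atTop (𝓝 θ))
    (hL : HasMean (fun n : ℕ => (u ((n : ℤ) + h) - lagVec u k n ⬝ᵥ θ) ^ 2) L)
    (hM : ∀ i : Fin k, HasMean (fun n : ℕ => u ((n : ℤ) - ((i : ℕ) : ℤ)) ^ 2) (M i)) :
    HasMean (fun n : ℕ => (u ((n : ℤ) + h) - lagVec u k n ⬝ᵥ θn n) ^ 2) L := by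
  set δ : Fin k → ℕ → ℝ := fun i n => θ i - θn n i with hδ
  have hδ0 : ∀ i, Tendsto (δ i) atTop (𝓝 0) := fun i => by
    have := (tendsto_const_nhds (x := θ i)).sub ((tendsto_pi_nhds.1 hθ) i)
    rwa [sub_self] at this
  set R : ℕ → ℝ := fun n => u ((n : ℤ) + h) - lagVec u k n ⬝ᵥ θ with hR
  -- The new error is `R + ∑ δ_i u_{n-i}`. After squaring, every term but `R²` has a null factor
  -- times a product whose absolute value is dominated by a Cesàro convergent sequence.
  have m1 : HasMean (fun n => ∑ i, δ i n * (lagVec u k n i * R n)) (∑ _i : Fin k, 0) :=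
    HasMean.sum _ fun i _ => HasMean.mul_null (hδ0 i) ((hM i).add hL) fun n =>
      abs_mul_le_sq_add_sq _ _
  have m2 : HasMean (fun n => ∑ i, ∑ j, δ i n * δ j n * (lagVec u k n i * lagVec u k n j))
      (∑ _i : Fin k, ∑ _j : Fin k, 0) :=
    HasMean.sum _ fun i _ => HasMean.sum _ fun j _ => by
      have h0 := (hδ0 i).mul (hδ0 j)
      rw [mul_zero] at h0
      exact HasMean.mul_null h0 ((hM i).add (hM j)) fun n => abs_mul_le_sq_add_sq _ _
  have m3 := (hL.add (m1.const_mul 2)).add m2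
  simp only [Finset.sum_const_zero, mul_zero, add_zero] at m3
  refine m3.congr fun n => ?_
  have e1 : lagVec u k n ⬝ᵥ θn n = lagVec u k n ⬝ᵥ θ - ∑ i, δ i n * lagVec u k n i := by
    simp only [dotProduct, hδ]
    rw [← Finset.sum_sub_distrib]
    exact Finset.sum_congr rfl fun i _ => by ring
  have e2 : ∑ i, δ i n * (lagVec u k n i * R n) = (∑ i, δ i n * lagVec u k n i) * R n := by
    rw [Finset.sum_mul]
    exact Finset.sum_congr rfl fun i _ => by ring
  have e3 : ∑ i, ∑ j, δ i n * δ j n * (lagVec u k n i * lagVec u k n j)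
      = (∑ i, δ i n * lagVec u k n i) ^ 2 := by
    rw [sq, Finset.sum_mul_sum]
    exact Finset.sum_congr rfl fun i _ => Finset.sum_congr rfl fun j _ => by ring
  rw [e1, e2, e3]
  simp only [hR]
  ring

/-- The normalisation of the estimators is asymptotically `1 / n`. -/
theorem tendsto_normalized_Icc {f : ℕ → ℝ} {L : ℝ} (hf : HasMean f L) (h k : ℕ) :
    Tendsto (fun n : ℕ => ((n : ℝ) - h - k + 1)⁻¹ * ∑ j ∈ Finset.Icc k (n - h), f j) atTop
      (𝓝 L) := by
  have h1 := hf.tendsto_Icc k h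
  have h2 : Tendsto (fun n : ℕ => (n : ℝ) / ((n : ℝ) - h - k + 1)) atTop (𝓝 1) := by
    have hden : Tendsto (fun n : ℕ => (n : ℝ) - h - k + 1) atTop atTop := by
      have : Tendsto (fun n : ℕ => (n : ℝ) + (-h - k + 1)) atTop atTop :=
        tendsto_natCast_atTop_atTop.atTop_add tendsto_const_nhds
      exact this.congr fun n => by ring
    have h3 : Tendsto (fun n : ℕ => ((h : ℝ) + k - 1) / ((n : ℝ) - h - k + 1)) atTop (𝓝 0) :=
      tendsto_const_nhds.div_atTop hden
    have h4 := h3.const_add 1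
    rw [add_zero] at h4
    refine h4.congr' ?_
    filter_upwards [hden.eventually_gt_atTop 0] with n hn
    field_simp
    ring
  have h3 := h2.mul h1
  rw [one_mul] at h3
  refine h3.congr' ?_
  filter_upwards [eventually_gt_atTop 0] with n hn
  have : (n : ℝ) ≠ 0 := by positivity
  rw [div_mul_div_comm, mul_comm ((n : ℝ) - h - k + 1), mul_div_mul_left _ _ this, div_eq_inv_mul]

/-- Consistency of the direct least-squares estimator. -/
theorem tendsto_directEst {G : Matrix (Fin k) (Fin k) ℝ} {g : Fin k → ℝ} (hdet : IsUnit G.det)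
    (hG : ∀ i j : Fin k, HasMean
      (fun n : ℕ => u ((n : ℤ) - ((i : ℕ) : ℤ)) * u ((n : ℤ) - ((j : ℕ) : ℤ))) (G i j))
    (hg : ∀ i : Fin k, HasMean
      (fun n : ℕ => u ((n : ℤ) + h) * u ((n : ℤ) - ((i : ℕ) : ℤ))) (g i)) :
    Tendsto (fun n => directEst u h k n) atTop (𝓝 (Matrix.mulVec G⁻¹ g)) := by
  have h1 : Tendsto (fun n => sampleCov u h k n) atTop (𝓝 G) := by
    refine tendsto_matrix_iff.2 fun i j => ?_
    refine (tendsto_normalized_Icc (hG i j) h k).congr fun n => ?_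
    rw [sampleCov, Matrix.smul_apply, Matrix.sum_apply, smul_eq_mul]
    rfl
  have h2 : Tendsto (fun n : ℕ => ((n : ℝ) - h - k + 1)⁻¹ •
      ∑ j ∈ Finset.Icc k (n - h), u ((j : ℤ) + h) • lagVec u k j) atTop (𝓝 g) := by
    refine tendsto_pi_nhds.2 fun i => ?_
    refine (tendsto_normalized_Icc (hg i) h k).congr fun n => ?_
    rw [Pi.smul_apply, Finset.sum_apply, smul_eq_mul]
    rfl
  -- Inversion is continuous at a nonsingular limit, so any singular sample matrices at early `n` do
  -- not matter.
  have hinv : ContinuousAt Inv.inv G := by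
    refine continuousAt_matrix_inv G ?_
    rw [Ring.inverse_eq_inv']
    exact continuousAt_inv₀ hdet.ne_zero
  have h3 : Tendsto (fun n => (sampleCov u h k n)⁻¹) atTop (𝓝 G⁻¹) := hinv.tendsto.comp h1
  refine tendsto_pi_nhds.2 fun i => ?_
  simp only [directEst, Matrix.mulVec, dotProduct]
  refine tendsto_finsetSum _ fun j _ => ?_
  exact (tendsto_matrix_iff.1 h3 i j).mul ((tendsto_pi_nhds.1 h2) j)

/-- Consistency of the plug-in coefficients reduces to that of the one-step estimator by continuity.
-/
theorem continuous_iterateCoef (h : ℕ) : Continuous (iterateCoef (k := k) h) := by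
  have hc : Continuous (fun c : Fin k → ℝ => companion c) := by
    refine continuous_matrix fun i j => ?_
    simp only [companion, Matrix.of_apply]
    split_ifs
    · exact continuous_apply i
    · exact continuous_const
    · exact continuous_const
  exact (hc.pow (h - 1)).matrix_mulVec continuous_id

end Path

/-! ### Linear prediction -/

section Prediction

variable {Ω : Type*} {mΩ : MeasurableSpace Ω} {μ : Measure Ω}
  {q : ℕ} {b : Fin q → ℝ} {x ε : ℤ → Ω → ℝ} {ℱ : Filtration ℤ mΩ} {σ α : ℝ}

theorem IsMartingaleNoise.memLp_eta (hε : IsMartingaleNoise μ ℱ σ α ε) {p : ℕ} (a : Fin p → ℝ)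
    (h : ℕ) (t : ℤ) : MemLp (fun ω => eta a (fun s => ε s ω) h t) 2 μ :=
  memLp_finsetSum _ fun _ _ => (hε.memLp _).const_mul _

namespace IsStableAR

theorem memLp_dotProduct (hx : IsStableAR μ q b x ε) (k : ℕ) (t : ℤ) (v : Fin k → ℝ) :
    MemLp (fun ω => lagVec (fun s => x s ω) k t ⬝ᵥ v) 2 μ :=
  memLp_finsetSum _ fun _ _ => (hx.stationary.memLp _).mul_const _

theorem integral_mul_dotProduct (hx : IsStableAR μ q b x ε) {f : Ω → ℝ} (hf : MemLp f 2 μ)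
    {k : ℕ} (t : ℤ) (v : Fin k → ℝ) :
    ∫ ω, f ω * (lagVec (fun s => x s ω) k t ⬝ᵥ v) ∂μ
      = ∑ i, v i * ∫ ω, f ω * x (t - ((i : ℕ) : ℤ)) ω ∂μ := by
  have e : ∀ ω, f ω * (lagVec (fun s => x s ω) k t ⬝ᵥ v)
      = ∑ i, v i * (f ω * x (t - ((i : ℕ) : ℤ)) ω) := fun ω => by
    rw [dotProduct, Finset.mul_sum]
    exact Finset.sum_congr rfl fun i _ => by simp only [lagVec]; ring
  have hi : ∀ i : Fin k, Integrable (fun ω => v i * (f ω * x (t - ((i : ℕ) : ℤ)) ω)) μ :=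
    fun i => (hf.integrable_mul (hx.stationary.memLp (t - ((i : ℕ) : ℤ)))).const_mul (v i)
  simp_rw [e]
  rw [integral_finsetSum _ fun i _ => hi i]
  exact Finset.sum_congr rfl fun i _ => integral_const_mul _ _

/-- The law of large numbers for squared prediction errors. -/
theorem hasMean_sq_sub_dotProduct (hx : IsStableAR μ q b x ε) {ω : Ω}
    (hω : ∀ s t : ℤ, HasMean (fun n : ℕ => x ((n : ℤ) + s) ω * x ((n : ℤ) + t) ω)
      (∫ ω, x s ω * x t ω ∂μ)) (h k : ℕ) (θ : Fin k → ℝ) :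
    HasMean (fun n : ℕ => (x ((n : ℤ) + h) ω - lagVec (fun s => x s ω) k n ⬝ᵥ θ) ^ 2)
      (∫ ω, (x (0 + h) ω - lagVec (fun s => x s ω) k 0 ⬝ᵥ θ) ^ 2 ∂μ) := by
  have hexp : ∀ (t : ℤ) (ω : Ω), (x (t + h) ω - lagVec (fun s => x s ω) k t ⬝ᵥ θ) ^ 2
      = x (t + h) ω * x (t + h) ω
        + ∑ i : Fin k, (-2 * θ i) * (x (t + h) ω * x (t + -((i : ℕ) : ℤ)) ω)
        + ∑ i : Fin k, ∑ j : Fin k, (θ i * θ j)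
          * (x (t + -((i : ℕ) : ℤ)) ω * x (t + -((j : ℕ) : ℤ)) ω) := by
    intro t ω
    have e1 : ∑ i : Fin k, (-2 * θ i) * (x (t + h) ω * x (t + -((i : ℕ) : ℤ)) ω)
        = -2 * x (t + h) ω * (lagVec (fun s => x s ω) k t ⬝ᵥ θ) := by
      rw [dotProduct, Finset.mul_sum]
      exact Finset.sum_congr rfl fun i _ => by
        simp only [lagVec, sub_eq_add_neg]; ring
    have e2 : ∑ i : Fin k, ∑ j : Fin k, (θ i * θ j)
          * (x (t + -((i : ℕ) : ℤ)) ω * x (t + -((j : ℕ) : ℤ)) ω)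
        = (lagVec (fun s => x s ω) k t ⬝ᵥ θ) ^ 2 := by
      rw [sq, dotProduct, Finset.sum_mul_sum]
      exact Finset.sum_congr rfl fun i _ => Finset.sum_congr rfl fun j _ => by
        simp only [lagVec, sub_eq_add_neg]; ring
    rw [e1, e2]
    ring
  have m := ((hω h h).add (HasMean.sum Finset.univ fun (i : Fin k) _ =>
    (hω h (-((i : ℕ) : ℤ))).const_mul (-2 * θ i))).add
    (HasMean.sum Finset.univ fun (i : Fin k) _ => HasMean.sum Finset.univ fun (j : Fin k) _ =>
      (hω (-((i : ℕ) : ℤ)) (-((j : ℕ) : ℤ))).const_mul (θ i * θ j))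
  have hlim : ∫ ω, (x (0 + h) ω - lagVec (fun s => x s ω) k 0 ⬝ᵥ θ) ^ 2 ∂μ
      = ∫ ω, x h ω * x h ω ∂μ
        + ∑ i : Fin k, (-2 * θ i) * ∫ ω, x h ω * x (-((i : ℕ) : ℤ)) ω ∂μ
        + ∑ i : Fin k, ∑ j : Fin k, (θ i * θ j)
          * ∫ ω, x (-((i : ℕ) : ℤ)) ω * x (-((j : ℕ) : ℤ)) ω ∂μ := by
    simp_rw [hexp, zero_add]
    have i1 : ∀ i : Fin k, Integrable
        (fun ω => (-2 * θ i) * (x h ω * x (-((i : ℕ) : ℤ)) ω)) μ :=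
      fun i => (hx.integrable_mul _ _).const_mul _
    have i2 : ∀ i j : Fin k, Integrable
        (fun ω => (θ i * θ j) * (x (-((i : ℕ) : ℤ)) ω * x (-((j : ℕ) : ℤ)) ω)) μ :=
      fun i j => (hx.integrable_mul _ _).const_mul _
    have i3 : Integrable (fun ω => x h ω * x h ω
        + ∑ i : Fin k, (-2 * θ i) * (x h ω * x (-((i : ℕ) : ℤ)) ω)) μ :=
      (hx.integrable_mul _ _).add (integrable_finsetSum _ fun i _ => i1 i)
    rw [integral_add i3 (integrable_finsetSum _ fun i _ => integrable_finsetSum _ fun j _ => i2 i j),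
      integral_add (hx.integrable_mul _ _) (integrable_finsetSum _ fun i _ => i1 i),
      integral_finsetSum _ fun i _ => i1 i,
      integral_finsetSum _ fun i _ => integrable_finsetSum _ fun j _ => i2 i j]
    simp_rw [integral_const_mul]
    congr 1
    refine Finset.sum_congr rfl fun i _ => ?_
    rw [integral_finsetSum _ fun j _ => i2 i j]
    simp_rw [integral_const_mul]
  rw [hlim]
  exact m.congr fun n => (hexp n ω).symm

variable [IsProbabilityMeasure μ]

/-- The `h`-step innovation is orthogonal to the past. -/
theorem integral_eta_mul_eq_zero (hx : IsStableAR μ q b x ε) (hε : IsMartingaleNoise μ ℱ σ α ε)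
    {p : ℕ} (a : Fin p → ℝ) (h : ℕ) {s t : ℤ} (hst : s ≤ t) :
    ∫ ω, eta a (fun s => ε s ω) h t * x s ω ∂μ = 0 := by
  have e : ∀ ω, eta a (fun s => ε s ω) h t * x s ω
      = ∑ j ∈ Finset.range h, maCoeff a j * (x s ω * ε (t + h - j) ω) := fun ω => by
    rw [eta, Finset.sum_mul]
    exact Finset.sum_congr rfl fun j _ => by ring
  simp_rw [e]
  rw [integral_finsetSum _ fun j _ => (hx.integrable_mul_noise hε _ _).const_mul _]
  refine Finset.sum_eq_zero fun j hj => ?_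
  have := Finset.mem_range.1 hj
  rw [integral_const_mul, hx.integral_mul_noise_of_lt hε (by omega), mul_zero]

theorem integral_eta_mul_dotProduct (hx : IsStableAR μ q b x ε)
    (hε : IsMartingaleNoise μ ℱ σ α ε) {p : ℕ} (a : Fin p → ℝ) (h : ℕ) (t : ℤ) {k : ℕ}
    (v : Fin k → ℝ) :
    ∫ ω, eta a (fun s => ε s ω) h t * (lagVec (fun s => x s ω) k t ⬝ᵥ v) ∂μ = 0 := by
  rw [hx.integral_mul_dotProduct (hε.memLp_eta a h t)]
  refine Finset.sum_eq_zero fun i _ => ?_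
  rw [hx.integral_eta_mul_eq_zero hε a h (by omega), mul_zero]

theorem autocov_add (hx : IsStableAR μ q b x ε) (hε : IsMartingaleNoise μ ℱ σ α ε) (t : ℤ)
    (h i : ℕ) : autocov μ x (h + i) = ∫ ω, x (t + h) ω * x (t - i) ω ∂μ := by
  have := hx.integral_mul_shift hε 0 (-((h : ℤ) + i)) (t + h)
  have e1 : (0 : ℤ) + (t + h) = t + h := by ring
  have e2 : -((h : ℤ) + i) + (t + h) = t - i := by ring
  rw [e1, e2] at this
  exact this.symm

/-- The normal equations. -/
theorem covMatrix_mulVec_directCoef (hx : IsStableAR μ q b x ε)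
    (hε : IsMartingaleNoise μ ℱ σ α ε) (hσ : 0 < σ) (h k : ℕ) (t : ℤ) (i : Fin k) :
    Matrix.mulVec (covMatrix μ x k) (directCoef μ x h k) i
      = ∫ ω, x (t + h) ω * x (t - ((i : ℕ) : ℤ)) ω ∂μ := by
  rw [directCoef, Matrix.mulVec_mulVec, Matrix.mul_nonsing_inv _ (hx.isUnit_det_covMatrix hε hσ k),
    Matrix.one_mulVec, hx.autocov_add hε t]

/-- The normal equations as orthogonality: the direct predictor is the `L²` projection onto the span
of the last `k` values. -/
theorem integral_residual_mul_dotProduct (hx : IsStableAR μ q b x ε)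
    (hε : IsMartingaleNoise μ ℱ σ α ε) (hσ : 0 < σ) (h k : ℕ) (t : ℤ) (v : Fin k → ℝ) :
    ∫ ω, (x (t + h) ω - lagVec (fun s => x s ω) k t ⬝ᵥ directCoef μ x h k)
      * (lagVec (fun s => x s ω) k t ⬝ᵥ v) ∂μ = 0 := by
  have hres : MemLp (fun ω => x (t + h) ω
      - lagVec (fun s => x s ω) k t ⬝ᵥ directCoef μ x h k) 2 μ :=
    (hx.stationary.memLp _).sub (hx.memLp_dotProduct k t _)
  rw [hx.integral_mul_dotProduct hres]
  refine Finset.sum_eq_zero fun i _ => ?_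
  have hxi := hx.stationary.memLp (t - ((i : ℕ) : ℤ))
  have i1 := hx.integrable_mul (t + h) (t - ((i : ℕ) : ℤ))
  have i2 : Integrable (fun ω => x (t - ((i : ℕ) : ℤ)) ω *
      (lagVec (fun s => x s ω) k t ⬝ᵥ directCoef μ x h k)) μ :=
    hxi.integrable_mul (hx.memLp_dotProduct k t _)
  have e : ∀ ω, (x (t + h) ω - lagVec (fun s => x s ω) k t ⬝ᵥ directCoef μ x h k)
      * x (t - ((i : ℕ) : ℤ)) ω = x (t + h) ω * x (t - ((i : ℕ) : ℤ)) ω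
      - x (t - ((i : ℕ) : ℤ)) ω * (lagVec (fun s => x s ω) k t ⬝ᵥ directCoef μ x h k) :=
    fun ω => by ring
  simp_rw [e]
  rw [integral_sub i1 i2, hx.integral_mul_dotProduct hxi,
    ← hx.covMatrix_mulVec_directCoef hε hσ h k t i, Matrix.mulVec, dotProduct,
    Finset.sum_congr rfl fun j _ => by rw [hx.covMatrix_apply hε t i j, mul_comm], sub_self,
    mul_zero]

/-- If the `h`-step innovation is what remains after a linear predictor, then this predictor is
the one given by the normal equations. -/
theorem directCoef_eq_of_ae (hx : IsStableAR μ q b x ε) (hε : IsMartingaleNoise μ ℱ σ α ε)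
    (hσ : 0 < σ) {p : ℕ} {a : Fin p → ℝ} {h k : ℕ} {c : Fin k → ℝ} {t : ℤ}
    (hc : ∀ᵐ ω ∂μ, x (t + h) ω
      = lagVec (fun s => x s ω) k t ⬝ᵥ c + eta a (fun s => ε s ω) h t) :
    directCoef μ x h k = c := by
  -- Testing the residual against the difference of the two predictors leaves the second moment of
  -- that difference, which must be zero; `Γ(k)` is definite.
  have h1 := hx.integral_residual_mul_dotProduct hε hσ h k t (c - directCoef μ x h k)
  have hd := hx.memLp_dotProduct k t (c - directCoef μ x h k)
  have i1 : Integrable (fun ω => eta a (fun s => ε s ω) h t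
      * (lagVec (fun s => x s ω) k t ⬝ᵥ (c - directCoef μ x h k))) μ :=
    (hε.memLp_eta a h t).integrable_mul hd
  have e : ∀ᵐ ω ∂μ, (x (t + h) ω - lagVec (fun s => x s ω) k t ⬝ᵥ directCoef μ x h k)
      * (lagVec (fun s => x s ω) k t ⬝ᵥ (c - directCoef μ x h k))
      = eta a (fun s => ε s ω) h t
          * (lagVec (fun s => x s ω) k t ⬝ᵥ (c - directCoef μ x h k))
        + (lagVec (fun s => x s ω) k t ⬝ᵥ (c - directCoef μ x h k)) ^ 2 := by
    filter_upwards [hc] with ω hω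
    rw [hω, dotProduct_sub]
    ring
  rw [integral_congr_ae e, integral_add i1 hd.integrable_sq,
    hx.integral_eta_mul_dotProduct hε, zero_add, hx.integral_lagVec_dotProduct_sq hε] at h1
  have h2 := hx.eq_zero_of_quadForm_eq_zero hε hσ h1
  exact (sub_eq_zero.1 h2).symm

/-- The mean-squared prediction error of an arbitrary linear predictor. -/
theorem integral_sq_sub_dotProduct (hx : IsStableAR μ q b x ε) (hε : IsMartingaleNoise μ ℱ σ α ε)
    (hσ : 0 < σ) {p : ℕ} {a : Fin p → ℝ} {h k m : ℕ} (hkm : k ≤ m) {t : ℤ}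
    (hc : ∀ᵐ ω ∂μ, x (t + h) ω
      = lagVec (fun s => x s ω) m t ⬝ᵥ directCoef μ x h m + eta a (fun s => ε s ω) h t)
    (θ : Fin k → ℝ) :
    ∫ ω, (x (t + h) ω - lagVec (fun s => x s ω) k t ⬝ᵥ θ) ^ 2 ∂μ
      - ∫ ω, eta a (fun s => ε s ω) h t ^ 2 ∂μ
      = quadForm (covMatrix μ x m) (directCoef μ x h m - zeroExtend m (directCoef μ x h k))
        + quadForm (covMatrix μ x k) (θ - directCoef μ x h k) := by
  -- The prediction error is `N + Y - Z`. `N` is orthogonal to the past, while `N + Y` is the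
  -- residual of the order-`k` projection and hence orthogonal to `Z`; so the three are pairwise
  -- orthogonal.
  set N : Ω → ℝ := fun ω => eta a (fun s => ε s ω) h t with hN
  set Y : Ω → ℝ := fun ω => lagVec (fun s => x s ω) m t
    ⬝ᵥ (directCoef μ x h m - zeroExtend m (directCoef μ x h k)) with hY
  set Z : Ω → ℝ := fun ω => lagVec (fun s => x s ω) k t ⬝ᵥ (θ - directCoef μ x h k) with hZ
  have hN2 : MemLp N 2 μ := hε.memLp_eta a h t
  have hY2 : MemLp Y 2 μ := hx.memLp_dotProduct m t _
  have hZ2 : MemLp Z 2 μ := hx.memLp_dotProduct k t _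
  have hres : ∀ᵐ ω ∂μ, x (t + h) ω - lagVec (fun s => x s ω) k t ⬝ᵥ directCoef μ x h k
      = N ω + Y ω := by
    filter_upwards [hc] with ω hω
    simp only [hN, hY]
    rw [hω, dotProduct_sub, lagVec_dotProduct_zeroExtend hkm]
    ring
  have oNY : ∫ ω, N ω * Y ω ∂μ = 0 := hx.integral_eta_mul_dotProduct hε a h t _
  have oNZ : ∫ ω, N ω * Z ω ∂μ = 0 := hx.integral_eta_mul_dotProduct hε a h t _
  have iNY : Integrable (fun ω => N ω * Y ω) μ := hN2.integrable_mul hY2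
  have iNZ : Integrable (fun ω => N ω * Z ω) μ := hN2.integrable_mul hZ2
  have iYZ : Integrable (fun ω => Y ω * Z ω) μ := hY2.integrable_mul hZ2
  have oYZ : ∫ ω, Y ω * Z ω ∂μ = 0 := by
    have h1 := hx.integral_residual_mul_dotProduct hε hσ h k t (θ - directCoef μ x h k)
    have h2 : ∫ ω, (x (t + h) ω - lagVec (fun s => x s ω) k t ⬝ᵥ directCoef μ x h k)
        * (lagVec (fun s => x s ω) k t ⬝ᵥ (θ - directCoef μ x h k)) ∂μ
        = ∫ ω, (N ω * Z ω + Y ω * Z ω) ∂μ :=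
      integral_congr_ae (hres.mono fun ω hω => by simp only [hω, hZ]; ring)
    rw [h2, integral_add iNZ iYZ, oNZ, zero_add] at h1
    exact h1
  have e : ∀ᵐ ω ∂μ, (x (t + h) ω - lagVec (fun s => x s ω) k t ⬝ᵥ θ) ^ 2
      = (N ω ^ 2 + Y ω ^ 2 + Z ω ^ 2) + 2 * (N ω * Y ω - N ω * Z ω - Y ω * Z ω) := by
    filter_upwards [hres] with ω hω
    have : x (t + h) ω - lagVec (fun s => x s ω) k t ⬝ᵥ θ = N ω + Y ω - Z ω := by
      rw [← hω]
      simp only [hZ, dotProduct_sub]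
      ring
    rw [this]
    ring
  have i1 : Integrable (fun ω => N ω ^ 2 + Y ω ^ 2) μ := hN2.integrable_sq.add hY2.integrable_sq
  have i2 : Integrable (fun ω => N ω ^ 2 + Y ω ^ 2 + Z ω ^ 2) μ := i1.add hZ2.integrable_sq
  have i3 : Integrable (fun ω => N ω * Y ω - N ω * Z ω) μ := iNY.sub iNZ
  have i4 : Integrable (fun ω => N ω * Y ω - N ω * Z ω - Y ω * Z ω) μ := i3.sub iYZ
  rw [integral_congr_ae e, integral_add i2 (i4.const_mul 2), integral_add i1 hZ2.integrable_sq,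
    integral_add hN2.integrable_sq hY2.integrable_sq, integral_const_mul, integral_sub i3 iYZ,
    integral_sub iNY iNZ, oNY, oNZ, oYZ, ← hx.integral_lagVec_dotProduct_sq hε t,
    ← hx.integral_lagVec_dotProduct_sq hε t]
  ring

/-- Any linear predictor is at least as bad as the innovation, with equality only if it leaves
the innovation. -/
theorem integral_sq_sub_dotProduct_of_ae (hx : IsStableAR μ q b x ε)
    (hε : IsMartingaleNoise μ ℱ σ α ε) {p m k : ℕ} {a : Fin p → ℝ} {h : ℕ} {c : Fin m → ℝ}
    {t : ℤ}
    (hc : ∀ᵐ ω ∂μ, x (t + h) ω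
      = lagVec (fun s => x s ω) m t ⬝ᵥ c + eta a (fun s => ε s ω) h t) (d : Fin k → ℝ) :
    ∫ ω, (x (t + h) ω - lagVec (fun s => x s ω) k t ⬝ᵥ d) ^ 2 ∂μ
      = ∫ ω, eta a (fun s => ε s ω) h t ^ 2 ∂μ
        + ∫ ω, (lagVec (fun s => x s ω) m t ⬝ᵥ c - lagVec (fun s => x s ω) k t ⬝ᵥ d) ^ 2 ∂μ := by
  have hN2 := hε.memLp_eta a h t
  have hC2 := hx.memLp_dotProduct m t c
  have hD2 := hx.memLp_dotProduct k t d
  have i1 : Integrable (fun ω => eta a (fun s => ε s ω) h t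
    * (lagVec (fun s => x s ω) m t ⬝ᵥ c)) μ := hN2.integrable_mul hC2
  have i2 : Integrable (fun ω => eta a (fun s => ε s ω) h t
    * (lagVec (fun s => x s ω) k t ⬝ᵥ d)) μ := hN2.integrable_mul hD2
  have hCD : MemLp (fun ω => lagVec (fun s => x s ω) m t ⬝ᵥ c
    - lagVec (fun s => x s ω) k t ⬝ᵥ d) 2 μ := hC2.sub hD2
  have e : ∀ᵐ ω ∂μ, (x (t + h) ω - lagVec (fun s => x s ω) k t ⬝ᵥ d) ^ 2
      = (eta a (fun s => ε s ω) h t ^ 2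
        + (lagVec (fun s => x s ω) m t ⬝ᵥ c - lagVec (fun s => x s ω) k t ⬝ᵥ d) ^ 2)
        + 2 * (eta a (fun s => ε s ω) h t * (lagVec (fun s => x s ω) m t ⬝ᵥ c)
          - eta a (fun s => ε s ω) h t * (lagVec (fun s => x s ω) k t ⬝ᵥ d)) := by
    filter_upwards [hc] with ω hω
    rw [hω]
    ring
  have i3 : Integrable (fun ω => eta a (fun s => ε s ω) h t ^ 2
        + (lagVec (fun s => x s ω) m t ⬝ᵥ c - lagVec (fun s => x s ω) k t ⬝ᵥ d) ^ 2) μ :=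
    hN2.integrable_sq.add hCD.integrable_sq
  have i4 : Integrable (fun ω => eta a (fun s => ε s ω) h t * (lagVec (fun s => x s ω) m t ⬝ᵥ c)
          - eta a (fun s => ε s ω) h t * (lagVec (fun s => x s ω) k t ⬝ᵥ d)) μ := i1.sub i2
  rw [integral_congr_ae e, integral_add i3 (i4.const_mul 2),
    integral_add hN2.integrable_sq hCD.integrable_sq, integral_const_mul, integral_sub i1 i2,
    hx.integral_eta_mul_dotProduct hε, hx.integral_eta_mul_dotProduct hε]
  ring

end IsStableAR

end Prediction

/-! ### Accumulated prediction errors -/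

section APE

variable {Ω : Type*} {mΩ : MeasurableSpace Ω} {μ : Measure Ω}
  {p : ℕ} {a : Fin p → ℝ} {x ε : ℤ → Ω → ℝ} {ℱ : Filtration ℤ mΩ} {σ α : ℝ}

namespace IsStationaryAR

/-- Coefficients that depend neither on the path nor on `t` allow a single null set for all times.
-/
theorem exists_predictor (hAR : IsStationaryAR μ p a x ε) (h : ℕ) :
    ∃ c : Fin p → ℝ, ∀ᵐ ω ∂μ, ∀ t : ℤ, x (t + h) ω
      = lagVec (fun s => x s ω) p t ⬝ᵥ c + eta a (fun s => ε s ω) h t := by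
  obtain ⟨i, _⟩ := hAR.order_exact
  obtain ⟨c, hc⟩ := exists_multistep_coef i.pos a h
  refine ⟨c, ?_⟩
  filter_upwards [ae_all_iff.2 hAR.recursion] with ω hω
  exact hc (fun s => x s ω) (fun s => ε s ω) hω

variable [IsProbabilityMeasure μ]

theorem ae_eq_directCoef (hAR : IsStationaryAR μ p a x ε) (hε : IsMartingaleNoise μ ℱ σ α ε)
    (hσ : 0 < σ) (h : ℕ) :
    ∀ᵐ ω ∂μ, ∀ t : ℤ, x (t + h) ω
      = lagVec (fun s => x s ω) p t ⬝ᵥ directCoef μ x h p + eta a (fun s => ε s ω) h t := by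
  obtain ⟨c, hc⟩ := hAR.exists_predictor h
  rw [(hAR.isStableAR le_rfl).directCoef_eq_of_ae hε hσ (t := 0) (hc.mono fun ω hω => hω 0)]
  exact hc

/-- The linear predictor of order `p_h` also leaves the `h`-step innovation. -/
theorem ae_eq_directCoef_predictionOrder (hAR : IsStationaryAR μ p a x ε)
    (hε : IsMartingaleNoise μ ℱ σ α ε) (hσ : 0 < σ) (h : ℕ) (t : ℤ) :
    ∀ᵐ ω ∂μ, x (t + h) ω = lagVec (fun s => x s ω) (predictionOrder μ x h) t
      ⬝ᵥ directCoef μ x h (predictionOrder μ x h) + eta a (fun s => ε s ω) h t := by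
  have hx := hAR.isStableAR le_rfl
  obtain ⟨c, hc⟩ := hAR.exists_predictor h
  have hc' : ∀ t : ℤ, ∀ᵐ ω ∂μ, x (t + h) ω
      = lagVec (fun s => x s ω) p t ⬝ᵥ c + eta a (fun s => ε s ω) h t :=
    fun t => hc.mono fun ω hω => hω t
  have hmse : ∀ t : ℤ, ∫ ω, (x (t + h) ω - lagVec (fun s => x s ω) p t ⬝ᵥ c) ^ 2 ∂μ
      = ∫ ω, eta a (fun s => ε s ω) h t ^ 2 ∂μ := fun t => by
    rw [hx.integral_sq_sub_dotProduct_of_ae hε (hc' t) c]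
    simp
  -- The set is nonempty, so the infimum defining `p_h` is attained and is not the default value of
  -- `sInf`.
  have hmem : p ∈ {p : ℕ | ∃ c : Fin p → ℝ, IsBestLinearPredictor μ x h p c} := by
    refine ⟨c, fun t N d => ?_⟩
    rw [hmse t, hx.integral_sq_sub_dotProduct_of_ae hε (hc' t) d]
    exact le_add_of_nonneg_right (integral_nonneg fun ω => sq_nonneg _)
  have hinf : ∃ d, IsBestLinearPredictor μ x h (predictionOrder μ x h) d :=
    Nat.sInf_mem ⟨p, hmem⟩
  obtain ⟨d, hd⟩ := hinf
  -- The optimal predictor with `p_h` lags cannot be worse than the one with `p` lags, whose error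
  -- is the innovation; the excess second moment is zero and the two agree almost surely.
  have hle := hd t p c
  rw [hmse t, hx.integral_sq_sub_dotProduct_of_ae hε (hc' t) d] at hle
  have h0 : ∫ ω, (lagVec (fun s => x s ω) p t ⬝ᵥ c
      - lagVec (fun s => x s ω) (predictionOrder μ x h) t ⬝ᵥ d) ^ 2 ∂μ = 0 :=
    le_antisymm (by linarith) (integral_nonneg fun ω => sq_nonneg _)
  have hL2 : MemLp (fun ω => lagVec (fun s => x s ω) p t ⬝ᵥ c
      - lagVec (fun s => x s ω) (predictionOrder μ x h) t ⬝ᵥ d) 2 μ :=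
    (hx.memLp_dotProduct p t c).sub (hx.memLp_dotProduct _ t d)
  rw [integral_eq_zero_iff_of_nonneg (fun ω => sq_nonneg _) hL2.integrable_sq] at h0
  have hfin : ∀ᵐ ω ∂μ, x (t + h) ω = lagVec (fun s => x s ω) (predictionOrder μ x h) t ⬝ᵥ d
      + eta a (fun s => ε s ω) h t := by
    filter_upwards [h0, hc' t] with ω h1 h2
    rw [h2, sub_eq_zero.1 (pow_eq_zero_iff two_ne_zero |>.1 h1)]
  rw [hx.directCoef_eq_of_ae hε hσ hfin]
  exact hfin

/-- Accumulated prediction errors of a predictor with almost surely convergent coefficients. -/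
theorem ae_tendsto_ape (hAR : IsStationaryAR μ p a x ε) (hε : IsMartingaleNoise μ ℱ σ α ε)
    (hσ : 0 < σ) (hα : 2 < α) (h k m : ℕ) (hkm : k ≤ m)
    (hm : ∀ᵐ ω ∂μ, x (0 + h) ω
      = lagVec (fun s => x s ω) m 0 ⬝ᵥ directCoef μ x h m + eta a (fun s => ε s ω) h 0)
    (M : Ω → ℕ) (θ : Fin k → ℝ) (θn : ℕ → Ω → Fin k → ℝ)
    (hθ : ∀ᵐ ω ∂μ, Tendsto (fun n => θn n ω) atTop (𝓝 θ)) :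
    ∀ᵐ ω ∂μ, Tendsto (fun n : ℕ => (1 / (n : ℝ)) *
        (∑ i ∈ Finset.Icc (M ω) (n - h),
            (x ((i : ℤ) + h) ω - lagVec (fun t => x t ω) k i ⬝ᵥ θn i ω) ^ 2
          - ∑ i ∈ Finset.Icc (M ω) (n - h), eta a (fun t => ε t ω) h i ^ 2)) atTop
      (𝓝 (quadForm (covMatrix μ x m) (directCoef μ x h m - zeroExtend m (directCoef μ x h k))
        + quadForm (covMatrix μ x k) (θ - directCoef μ x h k))) := by
  have hx := hAR.isStableAR le_rfl
  have hdir := hAR.ae_eq_directCoef hε hσ h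
  rw [← hx.integral_sq_sub_dotProduct hε hσ hkm hm θ]
  filter_upwards [hAR.ae_hasMean_mul hε hα, hθ, hdir] with ω hω hθω hdω
  have m1 := HasMean.sq_sub_of_tendsto (u := fun s => x s ω) hθω
    (hx.hasMean_sq_sub_dotProduct hω h k θ)
    (fun i => (hω (-((i : ℕ) : ℤ)) (-((i : ℕ) : ℤ))).congr fun n => by
      rw [sq, sub_eq_add_neg])
  -- The innovation is itself the prediction error at full order `p`, so its squares obey the same
  -- law of large numbers.
  have m2 : HasMean (fun n : ℕ => eta a (fun s => ε s ω) h n ^ 2)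
      (∫ ω, eta a (fun s => ε s ω) h 0 ^ 2 ∂μ) := by
    have h1 := hx.hasMean_sq_sub_dotProduct hω h p (directCoef μ x h p)
    have h2 : ∫ ω, (x (0 + h) ω - lagVec (fun s => x s ω) p 0 ⬝ᵥ directCoef μ x h p) ^ 2 ∂μ
        = ∫ ω, eta a (fun s => ε s ω) h 0 ^ 2 ∂μ :=
      integral_congr_ae (hdir.mono fun ω hω => by
        simp only
        rw [hω 0]
        ring)
    rw [h2] at h1
    refine h1.congr fun n => ?_
    rw [hdω n]
    ring
  -- Along a fixed path the random starting index is a constant, and finitely many initial terms do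
  -- not affect the limit.
  refine ((m1.sub m2).tendsto_Icc (M ω) h).congr fun n => ?_
  rw [Finset.sum_sub_distrib, one_div, div_eq_inv_mul]

theorem ae_tendsto_directEst (hAR : IsStationaryAR μ p a x ε) (hε : IsMartingaleNoise μ ℱ σ α ε)
    (hσ : 0 < σ) (hα : 2 < α) (h k : ℕ) :
    ∀ᵐ ω ∂μ, Tendsto (fun n => directEst (fun t => x t ω) h k n) atTop
      (𝓝 (directCoef μ x h k)) := by
  have hx := hAR.isStableAR le_rfl
  filter_upwards [hAR.ae_hasMean_mul hε hα] with ω hω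
  refine tendsto_directEst (u := fun t => x t ω) (hx.isUnit_det_covMatrix hε hσ k)
    (fun i j => ?_) (fun i => ?_)
  · rw [hx.covMatrix_apply hε 0, zero_sub, zero_sub]
    exact hω _ _
  · rw [hx.autocov_add hε 0, zero_add, zero_sub]
    exact hω _ _

end IsStationaryAR

end APE

end MultistepAR

theorem theorem3p3 {Ω : Type*} {mΩ : MeasurableSpace Ω} (μ : Measure Ω) [IsProbabilityMeasure μ]
    (p₁ : ℕ) (a : Fin p₁ → ℝ) (x ε : ℤ → Ω → ℝ)
    (ℱ : Filtration ℤ mΩ) (σ α : ℝ) (hσ : 0 < σ) (hα : 2 < α)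
    (hAR : MultistepAR.IsStationaryAR μ p₁ a x ε)
    (hε : MultistepAR.IsMartingaleNoise μ ℱ σ α ε)
    (h K : ℕ) (hh : 1 ≤ h) (hK : p₁ ≤ K) :
    (∀ k : ℕ, 1 ≤ k → k < p₁ →
      ∀ᵐ ω ∂μ, Tendsto
        (fun n : ℕ => (1 / (n : ℝ)) *
          (MultistepAR.apePlugIn (fun t => x t ω) h K k n -
            MultistepAR.sumEtaSq a (fun t => x t ω) (fun t => ε t ω) h K n))
        atTop
        (𝓝 (MultistepAR.quadForm (MultistepAR.covMatrix μ x p₁)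
              (MultistepAR.directCoef μ x h p₁ -
                MultistepAR.zeroExtend p₁ (MultistepAR.directCoef μ x h k)) +
            MultistepAR.quadForm (MultistepAR.covMatrix μ x k)
              (MultistepAR.plugInCoef μ x h k - MultistepAR.directCoef μ x h k)))) ∧
    (∀ k : ℕ, 1 ≤ k → k < MultistepAR.predictionOrder μ x h →
      ∀ᵐ ω ∂μ, Tendsto
        (fun n : ℕ => (1 / (n : ℝ)) *
          (MultistepAR.apeDirect (fun t => x t ω) h K k n -
            MultistepAR.sumEtaSq a (fun t => x t ω) (fun t => ε t ω) h K n))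
        atTop
        (𝓝 (MultistepAR.quadForm
              (MultistepAR.covMatrix μ x (MultistepAR.predictionOrder μ x h))
              (MultistepAR.directCoef μ x h (MultistepAR.predictionOrder μ x h) -
                MultistepAR.zeroExtend (MultistepAR.predictionOrder μ x h)
                  (MultistepAR.directCoef μ x h k))))) := by
  constructor
  · intro k _ hk
    -- Here the estimates tend to `𝐚(h, k)`, generally different from the projection `𝐚_D(h, k)`;
    -- hence the second quadratic form.
    refine hAR.ae_tendsto_ape hε hσ hα h k p₁ hk.le
      ((hAR.ae_eq_directCoef hε hσ h).mono fun ω hω => hω 0)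
      (fun ω => MultistepAR.startIndex (fun t => x t ω) h K) (MultistepAR.plugInCoef μ x h k)
      (fun n ω => MultistepAR.plugInEst (fun t => x t ω) h k n) ?_
    filter_upwards [hAR.ae_tendsto_directEst hε hσ hα 1 k] with ω hω
    exact ((MultistepAR.continuous_iterateCoef h).tendsto _).comp hω
  · intro k _ hk
    have hlim := hAR.ae_tendsto_ape hε hσ hα h k _ hk.le
      (hAR.ae_eq_directCoef_predictionOrder hε hσ h 0)
      (fun ω => MultistepAR.startIndex (fun t => x t ω) h K) (MultistepAR.directCoef μ x h k)
      (fun n ω => MultistepAR.directEst (fun t => x t ω) h k n)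
      (hAR.ae_tendsto_directEst hε hσ hα h k)
    -- The direct estimates tend to the projection coefficients themselves, so the second quadratic
    -- form is that of the zero vector.
    rw [sub_self] at hlim
    simpa [MultistepAR.quadForm, MultistepAR.apeDirect, MultistepAR.sumEtaSq] using hlim
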